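/- Let $d\ge 0$ be an integer and identify $\{0,1\}^d$ with $\mathbf{F}_2^d$, so that bitwise xor is addition. Let $K$ be a finite non-empty set of keys (for example $K=\{0,1\}^k$). An oracle algorithm $A$ is a probabilistic algorithm that has access to a function $f:\{0,1\}^d\to\{0,1\}^d$ by queries and outputs a bit $A(f)\in\{0,1\}$; the places being queried may depend on the previous answers and on the algorithm's own random choices, and no restriction is placed on its computational power. For a family of functions $F_s:\{0,1\}^d\to\{0,1\}^d$ $(s\in K)$ let $$\mathrm{Adv}_F^{\mathrm{PRF}}(m)=\sup_A\,\bigl|\mathbf{P}(A(F_s)=1)-\mathbf{P}(A(f)=1)\bigr|,$$ where $s$ is uniform in $K$, $f$ is a uniformly random function $\{0,1\}^d\to\{0,1\}^d$, and $A$ ranges over all oracle algorithms making at most $m$ queries. For a family of permutations $E_s$ $(s\in K)$ of $\{0,1\}^d$ let $$\mathrm{Adv}_E^{\mathrm{PRP}}(m)=\sup_A\,\bigl|\mathbf{P}(A(E_s)=1)-\mathbf{P}(A(\pi)=1)\bigr|,$$ where $s$ is uniform in $K$, $\pi$ is a uniformly random permutation of $\{0,1\}^d$, and $A$ ranges over the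 same algorithms (they query values of the permutation, not of its inverse). **Theorem.** There is an absolute constant $C>0$ such that the following holds for all $d$, all $K$, and every family $E=(E_s)_{s\in K}$ of permutations of $\{0,1\}^d$. Let $F$ be the family, with key set $K\times K$, defined by $F_{(s_1,s_2)}(x)=E_{s_1}(x)\oplus E_{s_2}(x)$, i.e. the xor of two independent draws from $E$. Then for every integer $0\le m<2^d$, $$\mathrm{Adv}_F^{\mathrm{PRF}}(m)\le 2\,\mathrm{Adv}_E^{\mathrm{PRP}}(m)+C\,\frac{m}{2^{3d/2}}.$$ -/

import Mathlib

noncomputable section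

/-- The set `{0,1}^d`, as the group `𝐅₂^d`: its addition is the bitwise xor. -/
abbrev Block (d : ℕ) : Type := Fin d → ZMod 2

/-- A probabilistic algorithm with access to an oracle `X → Y` that outputs one bit.
At each stage it either stops and outputs a bit, or queries the oracle at a place `x` and
continues depending on the answer, or draws a random number from a distribution of its choice and
continues depending on the outcome.
There is no restriction on its computational power. -/
inductive OracleAlg (X Y : Type) : Type
  | output (b : Bool) : OracleAlg X Y
  | query (x : X) (next : Y → OracleAlg X Y) : OracleAlg X Y
  | sample (μ : PMF ℕ) (next : ℕ → OracleAlg X Y) : OracleAlg X Y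

namespace OracleAlg

variable {X Y : Type}

/-- The distribution of the output bit when the oracle is the function `f`. -/
def run (f : X → Y) : OracleAlg X Y → PMF Bool
  | output b => PMF.pure b
  | query x next => run f (next (f x))
  | sample μ next => μ.bind fun i => run f (next i)

/-- The algorithm makes at most `m` oracle queries in every execution. -/
def QueriesAtMost : OracleAlg X Y → ℕ → Prop
  | output _, _ => True
  | query _ _, 0 => False
  | query _ next, m + 1 => ∀ y, QueriesAtMost (next y) m
  | sample _ next, m => ∀ i, QueriesAtMost (next i) m

/-- The probability that the algorithm outputs `1` when its oracle is drawn at random, namely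
the oracle is `F s` with `s` uniform in the finite non-empty set `S`. -/
def acceptProb {S : Type*} [Fintype S] [Nonempty S] (F : S → X → Y) (A : OracleAlg X Y) : ℝ :=
  (((PMF.uniformOfFintype S).bind fun s => A.run (F s)) true).toReal

/-- The advantage of `A` in distinguishing a random `F s` from a random `G t`. -/
def advantage {S T : Type*} [Fintype S] [Nonempty S] [Fintype T] [Nonempty T]
    (F : S → X → Y) (G : T → X → Y) (A : OracleAlg X Y) : ℝ :=
  |acceptProb F A - acceptProb G A|

theorem advantage_le_one {S T : Type*} [Fintype S] [Nonempty S] [Fintype T] [Nonempty T]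
    (F : S → X → Y) (G : T → X → Y) (A : OracleAlg X Y) : advantage F G A ≤ 1 := by
  have h : ∀ p : PMF Bool, 0 ≤ (p true).toReal ∧ (p true).toReal ≤ 1 := fun p =>
    ⟨ENNReal.toReal_nonneg, ENNReal.toReal_le_of_le_ofReal zero_le_one (by simpa using p.coe_le_one true)⟩
  unfold advantage acceptProb
  rw [abs_le]
  constructor <;>
    linarith [(h ((PMF.uniformOfFintype S).bind fun s => A.run (F s))).1,
      (h ((PMF.uniformOfFintype S).bind fun s => A.run (F s))).2,
      (h ((PMF.uniformOfFintype T).bind fun s => A.run (G s))).1,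
      (h ((PMF.uniformOfFintype T).bind fun s => A.run (G s))).2]

end OracleAlg

/-- The greatest advantage of an algorithm with at most `m` queries in distinguishing a random
`F s` from a random `G t`. -/
def maxAdvantage {X Y : Type} {S T : Type*} [Fintype S] [Nonempty S] [Fintype T] [Nonempty T]
    (F : S → X → Y) (G : T → X → Y) (m : ℕ) : ℝ :=
  ⨆ A : {A : OracleAlg X Y // A.QueriesAtMost m}, OracleAlg.advantage F G A.1

/-- The supremum in `maxAdvantage` is a genuine one. -/
theorem maxAdvantage_isLUB {X Y : Type} {S T : Type*} [Fintype S] [Nonempty S] [Fintype T]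
    [Nonempty T] (F : S → X → Y) (G : T → X → Y) (m : ℕ) :
    IsLUB (Set.range fun A : {A : OracleAlg X Y // A.QueriesAtMost m} =>
      OracleAlg.advantage F G A.1) (maxAdvantage F G m) := by
  have : Nonempty {A : OracleAlg X Y // A.QueriesAtMost m} :=
    ⟨⟨OracleAlg.output true, by simp [OracleAlg.QueriesAtMost]⟩⟩
  refine isLUB_ciSup ⟨1, ?_⟩
  rintro _ ⟨A, rfl⟩
  exact OracleAlg.advantage_le_one F G A.1

/-- `Adv_F^PRF(m)`: distinguishing `F s`, with `s` a uniformly random key, from a uniformly random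
function `{0,1}^d → {0,1}^d`. -/
def prfAdvantage {K : Type*} [Fintype K] [Nonempty K] {d : ℕ}
    (F : K → Block d → Block d) (m : ℕ) : ℝ :=
  maxAdvantage F (fun f : Block d → Block d => f) m

/-- `Adv_E^PRP(m)`: distinguishing `E s`, with `s` a uniformly random key, from a uniformly random
permutation of `{0,1}^d`. -/
def prpAdvantage {K : Type*} [Fintype K] [Nonempty K] {d : ℕ}
    (E : K → Equiv.Perm (Block d)) (m : ℕ) : ℝ :=
  maxAdvantage (fun s x => E s x) (fun (π : Equiv.Perm (Block d)) x => π x) m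

/-- The xor construction: a key is a pair of independent keys, and the function is the bitwise
xor of the two corresponding permutations. -/
def xorConstruction {K : Type*} {d : ℕ} (E : K → Equiv.Perm (Block d)) :
    K × K → Block d → Block d :=
  fun s x => E s.1 x + E s.2 x

end

open Finset

/-! A hybrid argument replaces the two keyed permutations by uniform ones. Each replacement costs at
most one PRP advantage, because a distinguisher can add the other summand to the answers by itself
(`abs_acceptProb_add_sub_le_prpAdvantage`). It remains to compare π₁ + π₂ with a uniform function;
put N = 2^d.

Let W be the difference of these two laws. It is invariant under permuting the places, so its
marginal on m distinct places does not depend on the places. Adaptivity therefore gains nothing, and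
the advantage is at most the ℓ¹ norm of that marginal (`abs_sum_mul_prob_le_leafSum`). By
Cauchy–Schwarz and Parseval its square is at most ∑ μ(α)⁴ over nonzero α supported on m given
places, where μ is `permMean`; the fourth power appears because the law of π₁ + π₂ is a convolution
square. The goal is thus a bound O(m²/N³) for this sum (`sum_permMean_pow_four_le`).

For m ≤ N/5 every α is sparse. If its support has k elements, then μ(α)² ≤ 1/C(N,k)
(`sq_permMean_mul_choose_le`), while the total of μ² over one fixed support obeys an exact recursion
(`levelWeight_recursion`) and is at most (2/N)(9/10)^(k-2). Multiplying by the number C(m,k) of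
supports and using C(m,k)/C(N,k) ≤ (m/N)² gives the bound.

For m > N/5 only O(1/N) is needed, and m < N leaves a place where all α vanish. If α takes one value
on more than 4N/5 places, subtracting that value makes it sparse without changing μ². The other α
are grouped by fibre sizes: the sum over all rearrangements of α is a coefficient of a product of
orthogonal linear forms, which AM–GM bounds on a torus (`sq_sum_fiberCard_eq_mul_le`). With
Stirling's bound this gives `sum_dense_permMean_pow_four_le`. -/

/-- A real-valued `±1` pairing of a finite group with itself, whose rows and columns are
orthogonal. -/
structure IsSignPairing {G : Type*} [AddCommGroup G] [Fintype G] [DecidableEq G]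
    (e : G → G → ℝ) : Prop where
  mul_self : ∀ a x, e a x * e a x = 1
  add_left : ∀ a b x, e (a + b) x = e a x * e b x
  add_right : ∀ a x y, e a (x + y) = e a x * e a y
  orth_left : ∀ x y, ∑ a, e a x * e a y = if x = y then (Fintype.card G : ℝ) else 0
  orth_right : ∀ a b, ∑ x, e a x * e b x = if a = b then (Fintype.card G : ℝ) else 0

/-! ### Fourier coefficients of the uniform permutation: symmetries and the pointwise bound -/

section PermMean

variable {G : Type*} [AddCommGroup G] [Fintype G] [DecidableEq G] {e : G → G → ℝ}

namespace IsSignPairing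

theorem zero_left (he : IsSignPairing e) (x : G) : e 0 x = 1 := by
  have h := he.add_left 0 0 x
  rw [add_zero, he.mul_self] at h
  exact h

theorem sum_right (he : IsSignPairing e) {a : G} (ha : a ≠ 0) : ∑ x, e a x = 0 := by
  simpa [he.zero_left, ha] using he.orth_right a 0

end IsSignPairing

/-- The average of `∏ x, e (α x) (π x)` over all permutations `π`: the Fourier coefficient at `α`
of the uniform distribution on permutations. -/
noncomputable def permMean (e : G → G → ℝ) (α : G → G) : ℝ :=
  (∑ π : Equiv.Perm G, ∏ x, e (α x) (π x)) / ((Fintype.card G).factorial : ℝ)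

/-- The places where `α` is nonzero. -/
def nonzeroSet (α : G → G) : Finset G := univ.filter fun x => α x ≠ 0

@[simp] theorem mem_nonzeroSet {α : G → G} {x : G} : x ∈ nonzeroSet α ↔ α x ≠ 0 := by
  simp [nonzeroSet]

theorem nonzeroSet_eq_empty {α : G → G} : nonzeroSet α = ∅ ↔ α = 0 := by
  simp [Finset.ext_iff, funext_iff]

theorem permMean_zero (he : IsSignPairing e) : permMean e 0 = 1 := by
  have : ((Fintype.card G).factorial : ℝ) ≠ 0 := by positivity
  simp [permMean, he.zero_left, Fintype.card_perm, this]

omit [AddCommGroup G] in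
theorem permMean_comp_perm (α : G → G) (σ : Equiv.Perm G) :
    permMean e (α ∘ σ) = permMean e α := by
  unfold permMean
  congr 1
  rw [← Equiv.sum_comp (Equiv.mulRight σ)]
  refine sum_congr rfl fun π _ => ?_
  exact Equiv.prod_comp σ fun x => e (α x) (π x)

/-- The shift multiplies every term by `∏ x, e c x`, a sign that does not depend on `π`. -/
theorem sq_permMean_add_const (he : IsSignPairing e) (α : G → G) (c : G) :
    permMean e (fun x => α x + c) ^ 2 = permMean e α ^ 2 := by
  have h : permMean e (fun x => α x + c) = (∏ x, e c x) * permMean e α := by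
    unfold permMean
    rw [mul_div_assoc', mul_sum]
    congr 1
    refine sum_congr rfl fun π _ => ?_
    rw [← Equiv.prod_comp π fun x => e c x, ← prod_mul_distrib]
    exact prod_congr rfl fun x _ => by rw [he.add_left, mul_comm]
  rw [h, mul_pow, ← prod_pow]
  simp [sq, he.mul_self]

/-- For fixed `π`, the point `π u` runs through the whole group, and a nontrivial character sums to
zero. -/
theorem sum_permMean_add_single (he : IsSignPairing e) (β : G → G) {γ : G} (hγ : γ ≠ 0) :
    ∑ u, permMean e (β + Pi.single u γ) = 0 := by
  unfold permMean
  rw [← sum_div, sum_comm]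
  have h : ∀ π : Equiv.Perm G, ∑ u, ∏ x, e ((β + Pi.single u γ : G → G) x) (π x) = 0 := by
    intro π
    have : ∀ u, ∏ x, e ((β + Pi.single u γ : G → G) x) (π x) = (∏ x, e (β x) (π x)) * e γ (π u) := by
      intro u
      simp only [Pi.add_apply, he.add_left, prod_mul_distrib]
      congr 1
      rw [Fintype.prod_eq_single u]
      · simp
      · intro x hx
        rw [Pi.single_eq_of_ne hx, he.zero_left]
    simp only [this]
    rw [← mul_sum, Equiv.sum_comp π fun x => e γ x, he.sum_right hγ, mul_zero]
  rw [sum_congr rfl fun π _ => h π, sum_const_zero, zero_div]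

/-- In the vanishing sum over all places `u`, those outside `S` contribute equally, since `β`
vanishes there and they can be swapped. This trades a place outside `S` for places inside it, so the
support shrinks. -/
theorem permMean_recursion (he : IsSignPairing e) {β : G → G} {S : Finset G} {x₀ γ : G}
    (hβ : nonzeroSet β ⊆ S) (hx : x₀ ∉ S) (hγ : γ ≠ 0) :
    ((Fintype.card G : ℝ) - S.card) * permMean e (β + Pi.single x₀ γ)
      = -∑ u ∈ S, permMean e (β + Pi.single u γ) := by
  have h0 := sum_permMean_add_single he β hγ
  rw [← sum_add_sum_compl S] at h0
  have hz : ∀ u, u ∉ S → β u = 0 := fun u hu => by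
    by_contra h
    exact hu (hβ (mem_nonzeroSet.2 h))
  have h1 : ∀ u ∈ Sᶜ, permMean e (β + Pi.single u γ) = permMean e (β + Pi.single x₀ γ) := by
    intro u hu
    rw [mem_compl] at hu
    have hc : (β + Pi.single u γ : G → G) = (β + Pi.single x₀ γ : G → G) ∘ Equiv.swap x₀ u := by
      funext x
      simp only [Pi.add_apply, Function.comp_apply, Equiv.swap_apply_def, Pi.single_apply]
      split_ifs <;> simp_all
    rw [hc, permMean_comp_perm]
  rw [sum_congr rfl h1, sum_const, card_compl, nsmul_eq_mul,
    Nat.cast_sub (card_le_univ S)] at h0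
  linarith

omit [Fintype G] in
theorem update_add_single (α : G → G) (x₀ : G) :
    Function.update α x₀ 0 + Pi.single x₀ (α x₀) = α := by
  funext x
  by_cases h : x = x₀
  · subst h; simp
  · simp [h]

theorem nonzeroSet_update_zero (α : G → G) (x₀ : G) :
    nonzeroSet (Function.update α x₀ 0) = (nonzeroSet α).erase x₀ := by
  ext x
  by_cases h : x = x₀ <;> simp [h]

/-- Square-root cancellation for sparse characters. -/
theorem sq_permMean_mul_choose_le (he : IsSignPairing e) (k : ℕ) :
    ∀ α : G → G, (nonzeroSet α).card = k → 2 * k ≤ Fintype.card G + 2 →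
      permMean e α ^ 2 * ((Fintype.card G).choose k : ℝ) ≤ 1 := by
  induction k using Nat.strong_induction_on with
  | _ k ih =>
  intro α hα hk
  set N := Fintype.card G with hN
  rcases Nat.eq_zero_or_pos k with rfl | hk0
  · rw [card_eq_zero, nonzeroSet_eq_empty] at hα
    simp [hα, permMean_zero he]
  obtain ⟨x₀, hx₀⟩ := card_pos.1 (hα ▸ hk0)
  set β := Function.update α x₀ 0 with hβ
  set S := (nonzeroSet α).erase x₀ with hS
  have hβS : nonzeroSet β = S := nonzeroSet_update_zero α x₀
  have hSc : S.card = k - 1 := by rw [hS, card_erase_of_mem hx₀, hα]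
  have hrec := permMean_recursion he (β := β) (S := S) (x₀ := x₀) (γ := α x₀)
    hβS.subset (by simp [hS]) (mem_nonzeroSet.1 hx₀)
  rw [update_add_single, ← hN, hSc] at hrec
  obtain ⟨j, rfl⟩ : ∃ j, k = j + 1 := ⟨k - 1, by omega⟩
  simp only [Nat.add_sub_cancel] at hrec hSc
  have hkN : j + 1 ≤ N := hα ▸ card_le_univ _
  have hjN : (0 : ℝ) < N - j := by
    have : ((j + 1 : ℕ) : ℝ) ≤ N := by exact_mod_cast hkN
    push_cast at this
    linarith
  rcases Nat.eq_zero_or_pos j with rfl | hj0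
  · have hS0 : S = ∅ := card_eq_zero.1 hSc
    rw [hS0, sum_empty, neg_zero] at hrec
    have : permMean e α = 0 := (mul_eq_zero.1 hrec).resolve_left hjN.ne'
    simp [this]
  obtain ⟨i, rfl⟩ : ∃ i, j = i + 1 := ⟨j - 1, by omega⟩
  have hC : (0 : ℝ) < N.choose i := by exact_mod_cast Nat.choose_pos (by omega)
  have hmono : (N.choose i : ℝ) ≤ N.choose (i + 1) := by
    exact_mod_cast Nat.choose_le_succ_of_lt_half_left (by omega)
  -- Adding a value at `u ∈ S` either keeps the support `S`, of size `i + 1`, or cancels `u` and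
  -- leaves size `i`. Binomials increase up to `N / 2`, so the bound for size `i` covers both.
  have hterm : ∀ u ∈ S, permMean e (β + Pi.single u (α x₀)) ^ 2 ≤ 1 / N.choose i := by
    intro u hu
    rw [le_div_iff₀ hC]
    have hsub1 : nonzeroSet (β + Pi.single u (α x₀)) ⊆ S := by
      intro x hx
      by_contra hxS
      have hxu : x ≠ u := fun h => hxS (h ▸ hu)
      have : β x = 0 := by
        by_contra h
        exact hxS (hβS ▸ mem_nonzeroSet.2 h)
      rw [mem_nonzeroSet] at hx
      simp [this, hxu] at hx
    have hsub2 : S.erase u ⊆ nonzeroSet (β + Pi.single u (α x₀)) := by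
      intro x hx
      rw [mem_erase, ← hβS, mem_nonzeroSet] at hx
      simp [hx.1, hx.2]
    have hc1 := card_le_card hsub1
    have hc2 := card_le_card hsub2
    rw [card_erase_of_mem hu] at hc2
    rw [hSc] at hc1 hc2
    obtain h | h : (nonzeroSet (β + Pi.single u (α x₀))).card = i ∨
      (nonzeroSet (β + Pi.single u (α x₀))).card = i + 1 := by omega
    · exact ih i (by omega) _ h (by omega)
    · exact (mul_le_mul_of_nonneg_left hmono (sq_nonneg _)).trans
        (ih (i + 1) (by omega) _ h (by omega))
  have hsum : (∑ u ∈ S, permMean e (β + Pi.single u (α x₀))) ^ 2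
      ≤ (i + 1 : ℝ) ^ 2 / N.choose i := by
    refine (sq_sum_le_card_mul_sum_sq).trans ?_
    rw [hSc]
    have := sum_le_sum hterm
    rw [sum_const, hSc, nsmul_eq_mul] at this
    push_cast at this ⊢
    calc (i + 1 : ℝ) * _ ≤ (i + 1 : ℝ) * ((i + 1) * (1 / N.choose i)) := by gcongr
      _ = _ := by ring
  have hsq : ((N : ℝ) - (i + 1 : ℕ)) ^ 2 * permMean e α ^ 2 ≤ (i + 1 : ℝ) ^ 2 / N.choose i := by
    rw [← mul_pow, hrec, neg_sq]
    exact hsum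
  rw [le_div_iff₀ hC] at hsq
  have hch1 : (N.choose (i + 1) : ℝ) * (i + 1) = N.choose i * (N - i) := by
    have := Nat.choose_succ_right_eq N i
    rw [← Nat.cast_sub (by omega : i ≤ N)]
    exact_mod_cast this
  have hch2 : (N.choose (i + 2) : ℝ) * (i + 2) = N.choose (i + 1) * (N - (i + 1)) := by
    have := Nat.choose_succ_right_eq N (i + 1)
    have h2 : ((N - (i + 1) : ℕ) : ℝ) = N - (i + 1) := by
      rw [Nat.cast_sub (by omega)]; push_cast; ring
    rw [← h2]
    exact_mod_cast this
  push_cast at hsq hjN hk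
  have hk' : (2 : ℝ) * i + 2 ≤ N := by
    have : 2 * i + 2 ≤ N := by omega
    exact_mod_cast this
  have hM := sq_nonneg (permMean e α)
  have hD : (0 : ℝ) < N - (i + 1) := by linarith
  have hkey : permMean e α ^ 2 * (N.choose (i + 2) : ℝ) * ((i + 2) * (i + 1) * (N - (i + 1)))
      ≤ (i + 1) ^ 2 * (N - i) := by
    calc _ = permMean e α ^ 2 * (N.choose (i + 2) * (i + 2)) * (i + 1) * (N - (i + 1)) := by ring
      _ = permMean e α ^ 2 * (N.choose (i + 1) * (i + 1)) * (N - (i + 1)) ^ 2 := by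
        rw [hch2]; ring
      _ = ((N - (i + 1)) ^ 2 * permMean e α ^ 2 * N.choose i) * (N - i) := by
        rw [hch1]; ring
      _ ≤ _ := by gcongr; linarith
  by_contra hcon
  rw [not_le] at hcon
  -- The difference of the sides is `(i + 1) * (N - 2 * i - 2)`; its sign is exactly the hypothesis
  -- `2 * k ≤ N + 2` for `k = i + 2`.
  have h3 : (i + 1 : ℝ) ^ 2 * (N - i) ≤ (i + 2) * (i + 1) * (N - (i + 1)) := by
    have hi : (0 : ℝ) ≤ i := by positivity
    nlinarith
  have h4 : (0 : ℝ) < (i + 2) * (i + 1) * (N - (i + 1)) := by positivity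
  nlinarith

end PermMean

/-! ### The ℓ² weight on a fixed support, and the sparse characters -/

section LevelWeight

variable {G : Type*} [AddCommGroup G] [Fintype G] [DecidableEq G] {e : G → G → ℝ}

theorem sum_nonzeroSet_eq_insert {S : Finset G} {x₀ : G} (hx : x₀ ∉ S) (f : (G → G) → ℝ) :
    ∑ α with nonzeroSet α = insert x₀ S, f α
      = ∑ β with nonzeroSet β = S, ∑ γ with γ ≠ 0, f (β + Pi.single x₀ γ) := by
  rw [← sum_product']
  symm
  have hz : ∀ β : G → G, nonzeroSet β = S → β x₀ = 0 := by
    rintro β rfl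
    simpa using hx
  refine sum_nbij' (fun p => p.1 + Pi.single x₀ p.2)
    (fun α => (Function.update α x₀ 0, α x₀)) ?_ ?_ ?_ ?_ ?_
  · rintro ⟨β, γ⟩ hp
    simp only [mem_product, mem_filter, mem_univ, true_and] at hp ⊢
    have h0 := hz β hp.1
    ext x
    rw [mem_insert, ← hp.1, mem_nonzeroSet, mem_nonzeroSet]
    by_cases h : x = x₀
    · subst h; simp [h0, hp.2]
    · simp [h]
  · intro α hα
    simp only [mem_product, mem_filter, mem_univ, true_and] at hα ⊢
    refine ⟨by rw [nonzeroSet_update_zero, hα, erase_insert hx], ?_⟩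
    rw [← mem_nonzeroSet, hα]
    exact mem_insert_self _ _
  · rintro ⟨β, γ⟩ hp
    simp only [mem_product, mem_filter, mem_univ, true_and] at hp ⊢
    have h0 := hz β hp.1
    refine Prod.ext ?_ (by simp [h0])
    funext x
    by_cases h : x = x₀
    · subst h; simp [h0]
    · simp [h]
  · intro α _
    exact update_add_single α x₀
  · intros; rfl

/-- The Fourier weight of the uniform distribution on permutations at the characters supported
exactly on `S`. -/
noncomputable def levelWeight (e : G → G → ℝ) (S : Finset G) : ℝ :=
  ∑ α with nonzeroSet α = S, permMean e α ^ 2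

/-- This is where injectivity enters: `π x ≠ π u`, so the columns of `e` at these two points are
orthogonal. -/
theorem sum_permMean_add_single_add_single (he : IsSignPairing e) (β : G → G) {x u : G}
    (hxu : x ≠ u) (ε : G) :
    ∑ γ, permMean e (β + Pi.single x γ + Pi.single u (ε + γ)) = 0 := by
  unfold permMean
  rw [← sum_div, sum_comm]
  have h : ∀ π : Equiv.Perm G,
      ∑ γ, ∏ y, e ((β + Pi.single x γ + Pi.single u (ε + γ) : G → G) y) (π y) = 0 := by
    intro π
    have hsingle : ∀ v δ, ∏ y, e ((Pi.single v δ : G → G) y) (π y) = e δ (π v) := by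
      intro v δ
      rw [Fintype.prod_eq_single v]
      · simp
      · intro y hy
        rw [Pi.single_eq_of_ne hy, he.zero_left]
    have : ∀ γ, ∏ y, e ((β + Pi.single x γ + Pi.single u (ε + γ) : G → G) y) (π y)
        = (∏ y, e (β y) (π y)) * e ε (π u) * (e γ (π x) * e γ (π u)) := by
      intro γ
      simp only [Pi.add_apply, he.add_left, prod_mul_distrib]
      rw [hsingle, hsingle, he.add_left]
      ring
    simp only [this]
    rw [← mul_sum, he.orth_left, if_neg (by simpa using hxu), mul_zero]
  rw [sum_congr rfl fun π _ => h π, sum_const_zero, zero_div]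

/-- Removing the two zero rows from a double sum whose diagonals vanish. -/
theorem sum_nonzero_mul_eq_of_diagonal_sum_eq_zero (q : G → G → ℝ) (p : G → ℝ)
    (h0 : ∀ δ, q 0 δ = p δ) (h1 : ∀ γ, q γ 0 = p γ) (hd : ∀ ε, ∑ γ, q γ (ε - γ) = 0) :
    ∑ δ with δ ≠ 0, ∑ γ with γ ≠ 0, q γ δ * p (γ + δ)
      = -(2 * (∑ ε with ε ≠ 0, p ε ^ 2) + p 0 ^ 2) := by
  -- Along each diagonal `γ + δ = ε` the factor `p ε` is constant.
  have hall : ∑ δ, ∑ γ, q γ δ * p (γ + δ) = 0 := by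
    rw [sum_comm]
    have : ∀ γ, ∑ δ, q γ δ * p (γ + δ) = ∑ ε, q γ (ε - γ) * p ε := by
      intro γ
      rw [← Equiv.sum_comp (Equiv.addLeft γ) fun ε => q γ (ε - γ) * p ε]
      simp
    simp only [this]
    rw [sum_comm]
    simp only [← sum_mul, hd, zero_mul, sum_const_zero]
  have hsplit : ∀ f : G → ℝ, ∑ δ, f δ = f 0 + ∑ δ with δ ≠ 0, f δ := by
    intro f
    rw [filter_ne', add_sum_erase _ _ (mem_univ 0)]
  rw [hsplit] at hall
  have hrow : ∀ δ, ∑ γ, q γ δ * p (γ + δ) = p δ ^ 2 + ∑ γ with γ ≠ 0, q γ δ * p (γ + δ) := by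
    intro δ
    rw [hsplit fun γ => q γ δ * p (γ + δ), h0, zero_add, sq]
  rw [hrow 0, sum_congr rfl fun δ _ => hrow δ, sum_add_distrib] at hall
  have h2 : ∑ γ with γ ≠ 0, q γ 0 * p (γ + 0) = ∑ ε with ε ≠ 0, p ε ^ 2 :=
    sum_congr rfl fun γ _ => by rw [h1, add_zero, sq]
  rw [h2] at hall
  linarith

/-- `permMean_recursion` is applied to one factor of each square. For each `u ∈ S` the resulting
cross terms, as a function of the values at `x₀` and `u`, have vanishing diagonal sums, so only the
rows where one of these values is zero survive. -/
theorem levelWeight_recursion (he : IsSignPairing e)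
    (hsymm : ∀ γ δ : G, γ + δ = 0 ↔ γ = δ)
    {S : Finset G} {x₀ : G} (hx : x₀ ∉ S) :
    ((Fintype.card G : ℝ) - S.card) * levelWeight e (insert x₀ S)
      = ∑ u ∈ S, (2 * levelWeight e S + levelWeight e (S.erase u)) := by
  have hneg : ∀ a : G, -a = a := fun a => by
    rw [neg_eq_iff_add_eq_zero, hsymm]
  unfold levelWeight
  rw [sum_nonzeroSet_eq_insert hx, mul_sum]
  have h1 : ∀ β : G → G, nonzeroSet β = S →
      ((Fintype.card G : ℝ) - S.card) * ∑ γ with γ ≠ 0, permMean e (β + Pi.single x₀ γ) ^ 2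
        = -∑ u ∈ S, ∑ γ with γ ≠ 0,
          permMean e (β + Pi.single u γ) * permMean e (β + Pi.single x₀ γ) := by
    intro β hβ
    rw [sum_comm, mul_sum, ← sum_neg_distrib]
    refine sum_congr rfl fun γ hγ => ?_
    have := permMean_recursion he hβ.subset hx (mem_filter.1 hγ).2
    rw [sq, ← mul_assoc, this, ← sum_mul, neg_mul]
  rw [sum_congr rfl fun β hβ => h1 β (mem_filter.1 hβ).2, sum_neg_distrib, sum_comm,
    ← sum_neg_distrib]
  refine sum_congr rfl fun u hu => ?_
  have hux : x₀ ≠ u := fun h => hx (h ▸ hu)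
  have hins : insert u (S.erase u) = S := insert_erase hu
  have hne : u ∉ S.erase u := notMem_erase u S
  have h2 := sum_nonzeroSet_eq_insert hne fun β => ∑ γ with γ ≠ 0,
          permMean e (β + Pi.single u γ) * permMean e (β + Pi.single x₀ γ)
  have h3 := sum_nonzeroSet_eq_insert hne fun β => permMean e β ^ 2
  rw [hins] at h2 h3
  rw [h2, h3, mul_sum, ← sum_add_distrib, ← sum_neg_distrib]
  refine sum_congr rfl fun β hβ => ?_
  rw [mem_filter] at hβ
  have hzero : ∀ x, x ∉ S.erase u → β x = 0 := fun x hx => by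
    by_contra h
    exact hx (hβ.2 ▸ mem_nonzeroSet.2 h)
  -- Here `γ` is the value at `x₀` and `δ` the value at `u`; moving both to `u` produces the
  -- argument `γ + δ`.
  have key := sum_nonzero_mul_eq_of_diagonal_sum_eq_zero
    (fun γ δ => permMean e (β + Pi.single x₀ γ + Pi.single u δ))
    (fun δ => permMean e (β + Pi.single u δ)) (fun δ => by simp) (fun γ => ?_) (fun ε => ?_)
  · simp only [Pi.single_zero, add_zero] at key
    rw [← neg_eq_iff_eq_neg] at key
    rw [← key]
    congr 1
    refine sum_congr rfl fun δ _ => sum_congr rfl fun γ _ => ?_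
    rw [mul_comm]
    congr 2
    · abel
    · rw [add_assoc, ← Pi.single_add, add_comm δ γ]
  · have hc : (β + Pi.single x₀ γ + Pi.single u 0 : G → G)
        = (β + Pi.single u γ : G → G) ∘ Equiv.swap x₀ u := by
      have hx0 : β x₀ = 0 := hzero _ fun h => hx (mem_of_mem_erase h)
      have hu0 : β u = 0 := hzero _ hne
      funext x
      simp only [Pi.add_apply, Function.comp_apply, Equiv.swap_apply_def, Pi.single_apply]
      split_ifs <;> simp_all
    simp only [hc, permMean_comp_perm]
  · simp only [sub_eq_add_neg, hneg]
    exact sum_permMean_add_single_add_single he β hux ε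

/-- The values of `levelWeight`, as a function of the size of the support. -/
noncomputable def weightSeq (N : ℕ) : ℕ → ℝ
  | 0 => 1
  | 1 => 0
  | k + 2 => (k + 1) / (N - (k + 1)) * (weightSeq N k + 2 * weightSeq N (k + 1))

theorem levelWeight_eq_weightSeq (he : IsSignPairing e)
    (hsymm : ∀ γ δ : G, γ + δ = 0 ↔ γ = δ) (k : ℕ) :
    ∀ S : Finset G, S.card = k → levelWeight e S = weightSeq (Fintype.card G) k := by
  induction k using Nat.strong_induction_on with
  | _ k ih =>
  intro S hS
  match k, ih, hS with
  | 0, _, hS =>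
    rw [card_eq_zero] at hS
    subst hS
    simp [levelWeight, nonzeroSet_eq_empty, weightSeq, Finset.filter_eq', permMean_zero he]
  | k + 1, ih, hS =>
    obtain ⟨x₀, S', hx, rfl, hS'⟩ := card_eq_succ.1 hS
    have hcard := card_le_univ (insert x₀ S')
    rw [hS] at hcard
    have hrec := levelWeight_recursion he hsymm hx
    have hpos : (0 : ℝ) < (Fintype.card G : ℝ) - k := by
      have : ((k + 1 : ℕ) : ℝ) ≤ Fintype.card G := by exact_mod_cast hcard
      push_cast at this
      linarith
    rw [hS', ih k (by omega) S' hS'] at hrec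
    match k, ih, hS', hrec, hpos with
    | 0, _, hS', hrec, hpos =>
      rw [card_eq_zero] at hS'
      rw [hS', sum_empty] at hrec
      rw [hS']
      exact (mul_eq_zero.1 hrec).resolve_left hpos.ne'
    | k + 1, ih, hS', hrec, hpos =>
      have : ∀ u ∈ S', 2 * weightSeq (Fintype.card G) (k + 1) + levelWeight e (S'.erase u)
          = 2 * weightSeq (Fintype.card G) (k + 1) + weightSeq (Fintype.card G) k := by
        intro u hu
        rw [ih k (by omega) _ (by rw [card_erase_of_mem hu, hS', Nat.add_sub_cancel])]
      rw [sum_congr rfl this, sum_const, hS', nsmul_eq_mul] at hrec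
      push_cast at hrec hpos
      rw [weightSeq, div_mul_eq_mul_div, eq_div_iff hpos.ne', mul_comm, hrec]
      ring

theorem weightSeq_nonneg {N : ℕ} (k : ℕ) (hk : k ≤ N) : 0 ≤ weightSeq N k := by
  induction k using Nat.strong_induction_on with
  | _ k ih =>
  match k, hk, ih with
  | 0, _, _ => simp [weightSeq]
  | 1, _, _ => simp [weightSeq]
  | k + 2, hk, ih =>
    have h1 := ih k (by omega) (by omega)
    have h2 := ih (k + 1) (by omega) (by omega)
    have : ((k + 2 : ℕ) : ℝ) ≤ N := by exact_mod_cast hk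
    push_cast at this
    have : (0 : ℝ) ≤ N - (k + 1) := by linarith
    rw [weightSeq]
    positivity

/-- The coefficient in the recursion is at most `1/4` in this range, and `(1 + 2 * 0.9) / 4 = 0.7 ≤
0.9 ^ 2`, so the rate `9/10` propagates. -/
theorem weightSeq_add_two_le {N : ℕ} (k : ℕ) (hk : 5 * (k + 2) ≤ N) :
    weightSeq N (k + 2) ≤ 2 / N * (9 / 10) ^ k := by
  induction k using Nat.strong_induction_on with
  | _ k ih =>
  have hN : (5 * (k + 2) : ℝ) ≤ N := by exact_mod_cast hk
  have hN0 : (0 : ℝ) < N := by linarith [(Nat.cast_nonneg k : (0 : ℝ) ≤ k)]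
  match k, hk, ih, hN with
  | 0, hk, ih, hN =>
    norm_num [weightSeq] at hN ⊢
    rw [inv_eq_one_div, div_le_div_iff₀ (by linarith) (by linarith)]
    linarith
  | 1, hk, ih, hN =>
    have h2 := ih 0 (by omega) (by omega)
    push_cast at hN
    rw [weightSeq]
    have h1 : weightSeq N 1 = 0 := rfl
    rw [h1]
    norm_num at h2 ⊢
    rw [div_mul_eq_mul_div, div_le_iff₀ (by linarith)]
    have : 2 / (N : ℝ) * (9 / 10) * (N - 2) ≥ 2 / (N : ℝ) * 4 := by
      rw [mul_assoc]
      gcongr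
      linarith
    linarith
  | k + 2, hk, ih, hN =>
    have h1 := ih k (by omega) (by omega)
    have h2 := ih (k + 1) (by omega) (by omega)
    have h3 := weightSeq_nonneg (N := N) (k + 2) (by omega)
    have h4 := weightSeq_nonneg (N := N) (k + 2 + 1) (by omega)
    push_cast at hN
    have hr : ((k + 2 : ℕ) + 1 : ℝ) / (N - ((k + 2 : ℕ) + 1)) ≤ 1 / 4 := by
      push_cast
      rw [div_le_div_iff₀ (by linarith) (by norm_num)]
      linarith
    rw [weightSeq]
    calc _ ≤ 1 / 4 * (weightSeq N (k + 2) + 2 * weightSeq N (k + 2 + 1)) := by gcongr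
      _ ≤ 1 / 4 * (2 / N * (9 / 10) ^ k + 2 * (2 / N * (9 / 10) ^ (k + 1))) := by
        gcongr
      _ = 2 / N * (9 / 10) ^ k * (7 / 10) := by ring
      _ ≤ 2 / N * (9 / 10) ^ k * (81 / 100) :=
        mul_le_mul_of_nonneg_left (by norm_num) (by positivity)
      _ = _ := by ring

/-- Passing from `k + 2` to `k + 3` multiplies the ratio of the binomials by `(m - (k + 2)) / (N -
(k + 2)) ≤ 1`, so the case of pairs is the worst. -/
theorem choose_mul_sq_le {m N : ℕ} (h : m ≤ N) (k : ℕ) :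
    m.choose (k + 2) * N ^ 2 ≤ N.choose (k + 2) * m ^ 2 := by
  induction k with
  | zero =>
    have h1 := Nat.choose_two_right m
    have h2 := Nat.choose_two_right N
    have e1 : m.choose 2 * 2 = m * (m - 1) := by
      rw [h1, Nat.div_mul_cancel (Nat.even_mul_pred_self m).two_dvd]
    have e2 : N.choose 2 * 2 = N * (N - 1) := by
      rw [h2, Nat.div_mul_cancel (Nat.even_mul_pred_self N).two_dvd]
    have h3 : (m - 1) * N ≤ (N - 1) * m := by
      rw [Nat.sub_mul, Nat.sub_mul, mul_comm m N]
      omega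
    have : m.choose 2 * N ^ 2 * 2 ≤ N.choose 2 * m ^ 2 * 2 := by
      calc m.choose 2 * N ^ 2 * 2 = (m.choose 2 * 2) * N ^ 2 := by ring
        _ = (m * N) * ((m - 1) * N) := by rw [e1]; ring
        _ ≤ (m * N) * ((N - 1) * m) := by gcongr
        _ = (N.choose 2 * 2) * m ^ 2 := by rw [e2]; ring
        _ = _ := by ring
    simpa using this
  | succ k ih =>
    have h1 := Nat.choose_succ_right_eq m (k + 2)
    have h2 := Nat.choose_succ_right_eq N (k + 2)
    have hsub : m - (k + 2) ≤ N - (k + 2) := by omega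
    refine Nat.le_of_mul_le_mul_right (c := k + 2 + 1) ?_ (by omega)
    calc m.choose (k + 1 + 2) * N ^ 2 * (k + 2 + 1)
        = (m.choose (k + 2) * N ^ 2) * (m - (k + 2)) := by
          rw [mul_right_comm, show k + 1 + 2 = k + 2 + 1 by ring, h1]; ring
      _ ≤ (N.choose (k + 2) * m ^ 2) * (N - (k + 2)) := by gcongr
      _ = N.choose (k + 1 + 2) * m ^ 2 * (k + 2 + 1) := by
          rw [mul_right_comm (N.choose (k + 1 + 2)), show k + 1 + 2 = k + 2 + 1 by ring, h2]; ring

/-- One factor `μ²` is bounded pointwise by `1 / C(N,k)`, the other is summed exactly over each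
support. -/
theorem sum_sparse_permMean_pow_four_le (he : IsSignPairing e)
    (hsymm : ∀ γ δ : G, γ + δ = 0 ↔ γ = δ) (T : Finset G) :
    ∑ α : G → G with α ≠ 0 ∧ nonzeroSet α ⊆ T ∧ 5 * (nonzeroSet α).card ≤ Fintype.card G,
        permMean e α ^ 4
      ≤ 20 * (T.card : ℝ) ^ 2 / (Fintype.card G : ℝ) ^ 3 := by
  set N := Fintype.card G with hN
  have hNpos : 0 < N := Fintype.card_pos
  set f : ℕ → ℝ := fun k =>
    if 1 ≤ k ∧ 5 * k ≤ N then weightSeq N k / N.choose k else 0 with hf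
  have hstep : ∑ α : G → G with α ≠ 0 ∧ nonzeroSet α ⊆ T ∧ 5 * (nonzeroSet α).card ≤ N,
      permMean e α ^ 4 ≤ ∑ S ∈ T.powerset, f S.card := by
    rw [← sum_fiberwise_of_maps_to (s := univ.filter fun α : G → G => α ≠ 0 ∧ nonzeroSet α ⊆ T ∧
        5 * (nonzeroSet α).card ≤ N) (t := T.powerset) (g := nonzeroSet)]
    · refine sum_le_sum fun S hS => ?_
      by_cases hc : 1 ≤ S.card ∧ 5 * S.card ≤ N
      · have hC : (0 : ℝ) < N.choose S.card := by
          exact_mod_cast Nat.choose_pos (card_le_univ S)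
        simp only [hf, hc, and_self, if_true]
        rw [← levelWeight_eq_weightSeq he hsymm _ S rfl, levelWeight, sum_div]
        refine (sum_le_sum (g := fun α => permMean e α ^ 2 / N.choose S.card) ?_).trans
          (sum_le_sum_of_subset_of_nonneg ?_ fun _ _ _ => by positivity)
        · intro α hα
          simp only [mem_filter] at hα
          have := sq_permMean_mul_choose_le he S.card α (by rw [hα.2]) (by omega)
          rw [le_div_iff₀ hC]
          calc _ = permMean e α ^ 2 * (permMean e α ^ 2 * N.choose S.card) := by ring
            _ ≤ permMean e α ^ 2 * 1 := by gcongr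
            _ = _ := mul_one _
        · intro α hα
          simp only [mem_filter, mem_univ, true_and] at hα ⊢
          exact hα.2
      · simp only [hf, hc, if_false]
        refine (sum_eq_zero fun α hα => ?_).le
        simp only [mem_filter, mem_univ, true_and] at hα
        obtain ⟨⟨h1, _, h3⟩, rfl⟩ := hα
        exact absurd ⟨card_pos.2 (nonempty_iff_ne_empty.2 fun h =>
          h1 (nonzeroSet_eq_empty.1 h)), h3⟩ hc
    · intro α hα
      simp only [mem_filter, mem_univ, true_and] at hα
      exact mem_powerset.2 hα.2.1
  refine hstep.trans ?_
  rw [sum_powerset_apply_card]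
  have hterm : ∀ k, T.card.choose (k + 2) • f (k + 2)
      ≤ (T.card : ℝ) ^ 2 / N ^ 2 * (2 / N) * (9 / 10) ^ k := by
    intro k
    simp only [hf]
    split_ifs with hk
    · have hC : (0 : ℝ) < N.choose (k + 2) := by
        exact_mod_cast Nat.choose_pos (by omega)
      have h1 := weightSeq_add_two_le k hk.2
      have h2 : ((T.card.choose (k + 2) : ℕ) : ℝ) * (N : ℝ) ^ 2
          ≤ N.choose (k + 2) * (T.card : ℝ) ^ 2 := by
        exact_mod_cast choose_mul_sq_le (card_le_univ T) k
      have h3 : ((T.card.choose (k + 2) : ℕ) : ℝ) / N.choose (k + 2)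
          ≤ (T.card : ℝ) ^ 2 / N ^ 2 := by
        rw [div_le_div_iff₀ hC (by positivity)]
        linarith
      have h4 := weightSeq_nonneg (N := N) (k + 2) (by omega)
      rw [nsmul_eq_mul]
      calc _ = ((T.card.choose (k + 2) : ℕ) : ℝ) / N.choose (k + 2) * weightSeq N (k + 2) := by
            ring
        _ ≤ (T.card : ℝ) ^ 2 / N ^ 2 * (2 / N * (9 / 10) ^ k) := by gcongr
        _ = _ := by ring
    · rw [smul_zero]
      positivity
  have hsum : ∑ k ∈ range (T.card + 1), T.card.choose k • f k
      ≤ ∑ k ∈ range T.card, (T.card : ℝ) ^ 2 / N ^ 2 * (2 / N) * (9 / 10) ^ k := by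
    -- Sizes 0 and 1 contribute nothing, so the sum starts with pairs; this is the source of the
    -- square of `T.card`.
    have hf0 : f 0 = 0 := by simp [hf]
    have hf1 : f 1 = 0 := by simp [hf, weightSeq]
    rw [sum_range_succ', hf0, smul_zero, add_zero]
    rcases Nat.eq_zero_or_pos T.card with h | h
    · rw [h]; simp
    · obtain ⟨j, hj⟩ : ∃ j, T.card = j + 1 := ⟨T.card - 1, by omega⟩
      have hext : ∑ k ∈ range T.card, T.card.choose (k + 1) • f (k + 1)
          = ∑ k ∈ range j, T.card.choose (k + 2) • f (k + 2) := by
        rw [show range T.card = range (j + 1) by rw [hj], sum_range_succ', zero_add, hf1,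
          smul_zero, add_zero]
      rw [hext]
      refine (sum_le_sum fun k _ => hterm k).trans
        (sum_le_sum_of_subset_of_nonneg (range_subset_range.2 (by omega))
          fun _ _ _ => by positivity)
  refine hsum.trans ?_
  rw [← mul_sum]
  have hgeom : ∑ k ∈ range T.card, (9 / 10 : ℝ) ^ k ≤ 10 := by
    have h := geom_sum_eq (show (9 / 10 : ℝ) ≠ 1 by norm_num) T.card
    rw [h]
    have : (0 : ℝ) ≤ (9 / 10) ^ T.card := by positivity
    rw [div_le_iff_of_neg (by norm_num)]
    linarith
  calc _ ≤ (T.card : ℝ) ^ 2 / N ^ 2 * (2 / N) * 10 := by gcongr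
    _ = _ := by field_simp; ring

end LevelWeight

/-! ### Grouping functions by their fibre sizes -/

section Types

variable {G : Type*} [Fintype G] [DecidableEq G]

/-- The number of places where `α` takes the value `c`. -/
def fiberCard (α : G → G) (c : G) : ℕ := (univ.filter fun x => α x = c).card

theorem prod_apply_eq_prod_pow_fiberCard {M : Type*} [CommMonoid M] (α : G → G) (f : G → M) :
    ∏ x, f (α x) = ∏ c, f c ^ fiberCard α c := by
  rw [← prod_fiberwise univ α fun x => f (α x)]
  refine prod_congr rfl fun c _ => ?_
  rw [prod_congr rfl fun x hx => by rw [(mem_filter.1 hx).2], prod_const, fiberCard]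

theorem sum_fiberCard (α : G → G) : ∑ c, fiberCard α c = Fintype.card G := by
  have := card_eq_sum_card_fiberwise (s := univ) (t := univ) (f := α) (fun x _ => by simp)
  rw [← card_univ, this]
  rfl

theorem fiberCard_le (α : G → G) (c : G) : fiberCard α c ≤ Fintype.card G := card_le_univ _

/-- The geometric mean of the relative sizes of the fibres of a function with fibre sizes `a`,
raised to the power of the number of places. -/
noncomputable def fiberDensity (G : Type*) [Fintype G] (a : G → ℕ) : ℝ :=
  ∏ c, ((a c : ℝ) / Fintype.card G) ^ a c

omit [DecidableEq G] in
theorem fiberDensity_pos (a : G → ℕ) : 0 < fiberDensity G a := by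
  refine prod_pos fun c _ => ?_
  have : Nonempty G := ⟨c⟩
  have hN : (0 : ℝ) < Fintype.card G := by exact_mod_cast Fintype.card_pos
  rcases Nat.eq_zero_or_pos (a c) with h | h
  · simp [h]
  · positivity

/-- If values are drawn independently with probabilities `fiberCard α c / N`, every rearrangement of
`α` has probability `fiberDensity`; the total is at most 1. -/
theorem card_fiberCard_eq_mul_fiberDensity_le (α : G → G) :
    ((univ.filter fun β => fiberCard β = fiberCard α).card : ℝ) * fiberDensity G (fiberCard α)
      ≤ 1 := by
  rcases isEmpty_or_nonempty G with hG | hG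
  · rw [show fiberDensity G (fiberCard α) = 1 by simp [fiberDensity], mul_one]
    have : (univ.filter fun β => fiberCard β = fiberCard α).card ≤ 1 := by
      rw [card_le_one]
      intro a _ b _
      exact Subsingleton.elim _ _
    exact_mod_cast this
  have hN : (0 : ℝ) < Fintype.card G := by exact_mod_cast Fintype.card_pos
  have h : ∑ β : G → G, ∏ x, ((fiberCard α (β x) : ℝ) / Fintype.card G) = 1 := by
    have := (prod_univ_sum (fun _ : G => (univ : Finset G))
      (fun _ c => (fiberCard α c : ℝ) / Fintype.card G)).symm
    rw [Fintype.piFinset_univ] at this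
    rw [this, prod_const, ← sum_div]
    have h2 : ∑ c, (fiberCard α c : ℝ) = Fintype.card G := by exact_mod_cast sum_fiberCard α
    rw [h2, div_self hN.ne', one_pow]
  rw [← h, ← nsmul_eq_mul, ← sum_const]
  refine (sum_le_sum fun β hβ => ?_).trans
    (sum_le_sum_of_subset_of_nonneg (subset_univ _) fun _ _ _ => by positivity)
  rw [prod_apply_eq_prod_pow_fiberCard β fun c => (fiberCard α c : ℝ) / Fintype.card G,
    (mem_filter.1 hβ).2, fiberDensity]

/-- The solutions form a coset of the stabilizer of `α`, which permutes each fibre freely. -/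
theorem card_perm_comp_eq (α β : G → G) :
    (univ.filter fun π : Equiv.Perm G => α ∘ π = β).card
      = if fiberCard β = fiberCard α then ∏ c, (fiberCard α c).factorial else 0 := by
  have hcard : ∀ (γ : G → G) (c : G), Fintype.card {x // γ x = c} = fiberCard γ c := fun γ c => by
    rw [Fintype.card_subtype, fiberCard]
  split_ifs with h
  · have hex : ∃ σ : Equiv.Perm G, ∀ x, α (σ x) = β x := by
      have e : ∀ c, Nonempty ({x // β x = c} ≃ {x // α x = c}) := fun c =>
        Fintype.card_eq.1 (by rw [hcard, hcard, h])
      exact ⟨Equiv.ofFiberEquiv fun c => (e c).some, fun x => Equiv.ofFiberEquiv_map _ x⟩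
    obtain ⟨σ, hσ⟩ := hex
    have hs := DomMulAct.stabilizer_card (α := G) (ι := G) α
    rw [Fintype.card_subtype] at hs
    simp only [hcard] at hs
    rw [← hs]
    refine card_bij' (fun π _ => π * σ.symm) (fun π _ => π * σ) ?_ ?_ ?_ ?_
    · intro π hπ
      simp only [mem_filter, mem_univ, true_and] at hπ ⊢
      funext x
      have := congrFun hπ (σ.symm x)
      simp only [Function.comp_apply, Equiv.Perm.coe_mul] at this ⊢
      rw [this, ← hσ, Equiv.apply_symm_apply]
    · intro π hπ
      simp only [mem_filter, mem_univ, true_and] at hπ ⊢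
      funext x
      have := congrFun hπ (σ x)
      simp only [Function.comp_apply, Equiv.Perm.coe_mul] at this ⊢
      rw [this, hσ]
    · intro π _
      ext x
      simp
    · intro π _
      ext x
      simp
  · rw [card_eq_zero, filter_eq_empty_iff]
    rintro π - rfl
    refine h (funext fun c => ?_)
    exact card_bij' (fun x _ => π x) (fun x _ => π⁻¹ x) (by simp) (by simp) (by simp) (by simp)

variable {e : G → G → ℝ}

theorem factorial_mul_permMean (α : G → G) :
    ((Fintype.card G).factorial : ℝ) * permMean e α
      = (∏ c, ((fiberCard α c).factorial : ℝ))
        * ∑ β with fiberCard β = fiberCard α, ∏ x, e (β x) x := by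
  have hfac : ((Fintype.card G).factorial : ℝ) ≠ 0 := by positivity
  have h1 : ∑ π : Equiv.Perm G, ∏ x, e (α x) (π x)
      = ∑ π : Equiv.Perm G, ∏ x, e ((α ∘ π) x) x := by
    rw [← Equiv.sum_comp (Equiv.inv (Equiv.Perm G))]
    refine sum_congr rfl fun π _ => ?_
    rw [← Equiv.prod_comp π]
    simp
  rw [permMean, mul_div_cancel₀ _ hfac, h1,
    ← sum_fiberwise univ (fun π : Equiv.Perm G => α ∘ π), mul_sum, sum_filter]
  refine sum_congr rfl fun β _ => ?_
  rw [sum_congr rfl fun π hπ => by rw [(mem_filter.1 hπ).2], sum_const, card_perm_comp_eq,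
    nsmul_eq_mul]
  split_ifs <;> simp

theorem permMean_eq_of_fiberCard_eq {α β : G → G} (h : fiberCard β = fiberCard α) :
    permMean e β = permMean e α := by
  have hfac : ((Fintype.card G).factorial : ℝ) ≠ 0 := by positivity
  have h1 := factorial_mul_permMean (e := e) α
  have h2 := factorial_mul_permMean (e := e) β
  rw [h, ← h1] at h2
  exact mul_left_cancel₀ hfac h2

end Types

/-! ### Bounding a coefficient of a product of orthogonal linear forms -/

section Torus

variable {G : Type*} [AddCommGroup G] [Fintype G] [DecidableEq G] {e : G → G → ℝ}

theorem IsSignPairing.sum_sq_linear (he : IsSignPairing e) (r : G → ℝ) :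
    ∑ x, (∑ c, r c * e c x) ^ 2 = Fintype.card G * ∑ c, r c ^ 2 := by
  have h : ∀ x, (∑ c, r c * e c x) ^ 2 = ∑ c, ∑ c', r c * r c' * (e c x * e c' x) := by
    intro x
    rw [sq, sum_mul_sum]
    exact sum_congr rfl fun c _ => sum_congr rfl fun c' _ => by ring
  simp only [h]
  rw [sum_comm, mul_sum]
  refine sum_congr rfl fun c _ => ?_
  rw [sum_comm]
  simp only [← mul_sum, he.orth_right]
  simp
  ring

theorem IsSignPairing.sum_norm_sq_linear (he : IsSignPairing e) (z : G → ℂ) :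
    ∑ x, ‖∑ c, z c * (e c x : ℂ)‖ ^ 2 = Fintype.card G * ∑ c, ‖z c‖ ^ 2 := by
  have h : ∀ w : ℂ, ‖w‖ ^ 2 = w.re ^ 2 + w.im ^ 2 := fun w => by
    rw [← Complex.normSq_eq_norm_sq, Complex.normSq_apply]; ring
  simp only [h, sum_add_distrib, mul_add]
  rw [← he.sum_sq_linear fun c => (z c).re, ← he.sum_sq_linear fun c => (z c).im]
  simp [Complex.re_sum, Complex.im_sum]

/-- AM–GM: by orthogonality the squared norms of the factors have mean 1. It is carried out through
`t ≤ exp (t - 1)`, where the exponents add up to 0. -/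
theorem IsSignPairing.norm_prod_linear_le (he : IsSignPairing e) (z : G → ℂ)
    (hz : ∑ c, ‖z c‖ ^ 2 = 1) : ‖∏ x, ∑ c, z c * (e c x : ℂ)‖ ≤ 1 := by
  have h1 : ‖∏ x, ∑ c, z c * (e c x : ℂ)‖ ^ 2 ≤ 1 := by
    rw [norm_prod, ← prod_pow]
    calc ∏ x, ‖∑ c, z c * (e c x : ℂ)‖ ^ 2
        ≤ ∏ x, Real.exp (‖∑ c, z c * (e c x : ℂ)‖ ^ 2 - 1) := by
          refine prod_le_prod (fun _ _ => by positivity) fun x _ => ?_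
          have := Real.add_one_le_exp (‖∑ c, z c * (e c x : ℂ)‖ ^ 2 - 1)
          linarith
      _ = 1 := by
          rw [← Real.exp_sum, sum_sub_distrib, he.sum_norm_sq_linear, hz]
          simp
  exact (sq_le_one_iff₀ (norm_nonneg _)).1 h1

omit [AddCommGroup G] in
theorem sum_prod_stdAddChar (n : ℕ) [NeZero n] (j₁ j₂ : G → G)
    (h₁ : ∀ c, fiberCard j₁ c < n) (h₂ : ∀ c, fiberCard j₂ c < n) :
    ∑ t : G → ZMod n, (∏ x, ZMod.stdAddChar (t (j₁ x))) * ∏ x, ZMod.stdAddChar (-t (j₂ x))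
      = if fiberCard j₁ = fiberCard j₂ then (n : ℂ) ^ Fintype.card G else 0 := by
  have h : ∀ t : G → ZMod n,
      (∏ x, ZMod.stdAddChar (t (j₁ x))) * ∏ x, ZMod.stdAddChar (-t (j₂ x))
        = ∏ c, (ZMod.stdAddChar (t c * ((fiberCard j₁ c : ZMod n) - (fiberCard j₂ c : ZMod n))) : ℂ) := by
    intro t
    rw [prod_apply_eq_prod_pow_fiberCard j₁ fun c => (ZMod.stdAddChar (t c) : ℂ),
      prod_apply_eq_prod_pow_fiberCard j₂ fun c => (ZMod.stdAddChar (-t c) : ℂ),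
      ← prod_mul_distrib]
    refine prod_congr rfl fun c _ => ?_
    rw [← AddChar.map_nsmul_eq_pow, ← AddChar.map_nsmul_eq_pow, ← AddChar.map_add_eq_mul]
    congr 1
    simp only [nsmul_eq_mul]
    ring
  simp only [h]
  have hs := (prod_univ_sum (fun _ : G => (univ : Finset (ZMod n)))
    (fun c t => (ZMod.stdAddChar (t * ((fiberCard j₁ c : ZMod n) - (fiberCard j₂ c : ZMod n))) : ℂ))).symm
  rw [Fintype.piFinset_univ] at hs
  rw [hs]
  simp only [AddChar.sum_mulShift _ (ZMod.isPrimitive_stdAddChar n), ZMod.card]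
  have hiff : ∀ c, ((fiberCard j₁ c : ZMod n) - (fiberCard j₂ c : ZMod n) = 0)
      ↔ fiberCard j₁ c = fiberCard j₂ c := by
    intro c
    rw [sub_eq_zero, ZMod.natCast_eq_natCast_iff, Nat.ModEq, Nat.mod_eq_of_lt (h₁ c),
      Nat.mod_eq_of_lt (h₂ c)]
  split_ifs with heq
  · rw [prod_congr rfl fun c _ => by rw [if_pos ((hiff c).2 (congrFun heq c))]]
    simp
  · obtain ⟨c, hc⟩ := Function.ne_iff.1 heq
    refine prod_eq_zero (mem_univ c) ?_
    rw [if_neg fun h => hc ((hiff c).1 h), Nat.cast_zero]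

/-- The sum over all rearrangements of `α` is a coefficient of a product of orthogonal linear
forms; bounding the product on a torus bounds the coefficient. -/
theorem sq_sum_fiberCard_eq_mul_le (he : IsSignPairing e) (α : G → G) :
    (∑ β with fiberCard β = fiberCard α, ∏ x, e (β x) x) ^ 2 * fiberDensity G (fiberCard α)
      ≤ 1 := by
  have hN : (0 : ℝ) < Fintype.card G := by exact_mod_cast Fintype.card_pos
  -- The torus is discretized by `n`-th roots of unity; `n` exceeds every fibre size, so fibre sizes
  -- are determined modulo `n` and the average extracts exactly one coefficient.
  set n := Fintype.card G + 1 with hn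
  have hlt : ∀ (β : G → G) c, fiberCard β c < n := fun β c => Nat.lt_succ_of_le (fiberCard_le β c)
  -- These radii have squares adding up to 1, and the squared modulus of the monomial of `α` becomes
  -- `fiberDensity`.
  set ρ : G → ℝ := fun c => √((fiberCard α c : ℝ) / Fintype.card G) with hρ
  have hρ2 : ∀ c, ρ c ^ 2 = (fiberCard α c : ℝ) / Fintype.card G := fun c =>
    Real.sq_sqrt (by positivity)
  set s := ∑ β with fiberCard β = fiberCard α, ∏ x, e (β x) x with hs
  have hsum : ∑ t : G → ZMod n,
      (∏ x, ∑ c, ((ρ c : ℂ) * ZMod.stdAddChar (t c)) * (e c x : ℂ))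
        * ∏ x, ZMod.stdAddChar (-t (α x))
      = (n : ℂ) ^ Fintype.card G * (((∏ x, ρ (α x)) * s : ℝ) : ℂ) := by
    have hexp : ∀ t : G → ZMod n,
        (∏ x, ∑ c, ((ρ c : ℂ) * ZMod.stdAddChar (t c)) * (e c x : ℂ))
          * ∏ x, ZMod.stdAddChar (-t (α x))
        = ∑ β : G → G, (((∏ x, ρ (β x)) * ∏ x, e (β x) x : ℝ) : ℂ) *
          ((∏ x, ZMod.stdAddChar (t (β x))) * ∏ x, ZMod.stdAddChar (-t (α x))) := by
      intro t
      rw [prod_univ_sum, Fintype.piFinset_univ, sum_mul]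
      refine sum_congr rfl fun β _ => ?_
      push_cast
      simp only [prod_mul_distrib]
      ring
    simp only [hexp]
    rw [sum_comm]
    simp only [← mul_sum]
    rw [sum_congr rfl fun β _ => by rw [sum_prod_stdAddChar n β α (hlt β) (hlt α)]]
    simp only [mul_ite, mul_zero]
    rw [← sum_filter, ← sum_mul, mul_comm, ← Complex.ofReal_sum]
    congr 2
    rw [hs, mul_sum]
    refine sum_congr rfl fun β hβ => ?_
    rw [prod_apply_eq_prod_pow_fiberCard β ρ, prod_apply_eq_prod_pow_fiberCard α ρ,
      (mem_filter.1 hβ).2]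
  have hnorm : (n : ℝ) ^ Fintype.card G * |(∏ x, ρ (α x)) * s| ≤ (n : ℝ) ^ Fintype.card G := by
    have h1 := congrArg norm hsum
    rw [norm_mul, norm_pow, Complex.norm_natCast, Complex.norm_real, Real.norm_eq_abs] at h1
    rw [← h1]
    refine (norm_sum_le _ _).trans ?_
    have hterm : ∀ t : G → ZMod n, ‖(∏ x, ∑ c, ((ρ c : ℂ) * ZMod.stdAddChar (t c)) * (e c x : ℂ))
        * ∏ x, ZMod.stdAddChar (-t (α x))‖ ≤ 1 := by
      intro t
      rw [norm_mul, norm_prod univ fun x => (ZMod.stdAddChar (-t (α x)) : ℂ)]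
      simp only [AddChar.norm_apply, prod_const_one, mul_one]
      refine he.norm_prod_linear_le _ ?_
      simp only [norm_mul, AddChar.norm_apply, mul_one, Complex.norm_real, Real.norm_eq_abs,
        sq_abs, hρ2]
      rw [← sum_div]
      have h2 : ∑ c, (fiberCard α c : ℝ) = Fintype.card G := by exact_mod_cast sum_fiberCard α
      rw [h2, div_self hN.ne']
    refine (sum_le_sum fun t _ => hterm t).trans ?_
    simp
  have hnpos : (0 : ℝ) < (n : ℝ) ^ Fintype.card G := by positivity
  have habs : |(∏ x, ρ (α x)) * s| ≤ 1 := by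
    by_contra h
    rw [not_le] at h
    nlinarith
  have hdens : (∏ x, ρ (α x)) ^ 2 = fiberDensity G (fiberCard α) := by
    rw [prod_apply_eq_prod_pow_fiberCard α ρ, fiberDensity, ← prod_pow]
    refine prod_congr rfl fun c _ => ?_
    rw [← pow_mul, mul_comm, pow_mul, hρ2]
  rw [← hdens, ← mul_pow, mul_comm, ← sq_abs]
  exact pow_le_one₀ (abs_nonneg _) habs

end Torus

/-! ### Stirling bounds and the dense characters -/

theorem factorial_le_exp_one_mul (a : ℕ) (ha : a ≠ 0) :
    (a.factorial : ℝ) ≤ Real.exp 1 * a * a ^ a * Real.exp (-a) := by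
  induction a with
  | zero => exact absurd rfl ha
  | succ a ih =>
    rcases Nat.eq_zero_or_pos a with rfl | hpos
    · simp [← Real.exp_add]
    have h1 := ih hpos.ne'
    have hap : (0 : ℝ) < a := by exact_mod_cast hpos
    have h2 : (a : ℝ) / (a + 1) ≤ Real.exp (-(1 / (a + 1))) := by
      have h := Real.add_one_le_exp (-(1 / ((a : ℝ) + 1)))
      have : -(1 / ((a : ℝ) + 1)) + 1 = a / (a + 1) := by field_simp; ring
      rwa [this] at h
    have h3 : ((a : ℝ) / (a + 1)) ^ (a + 1) ≤ Real.exp (-1) := by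
      refine (pow_le_pow_left₀ (by positivity) h2 _).trans_eq ?_
      rw [← Real.exp_nat_mul]
      congr 1
      push_cast
      field_simp
    rw [div_pow, div_le_iff₀ (by positivity)] at h3
    rw [Nat.factorial_succ]
    push_cast
    have h4 : Real.exp (-((a : ℝ) + 1)) = Real.exp (-a) * Real.exp (-1) := by
      rw [← Real.exp_add]; congr 1; ring
    calc ((a : ℝ) + 1) * a.factorial
        ≤ (a + 1) * (Real.exp 1 * a * a ^ a * Real.exp (-a)) := by gcongr
      _ = (a + 1) * Real.exp 1 * Real.exp (-a) * a ^ (a + 1) := by ring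
      _ ≤ (a + 1) * Real.exp 1 * Real.exp (-a) * (Real.exp (-1) * (a + 1) ^ (a + 1)) := by gcongr
      _ = _ := by rw [h4]; ring

/-- The loss factor in Stirling's upper bound for `a!`. -/
noncomputable def stirlingLoss (a : ℕ) : ℝ := if a = 0 then 1 else Real.exp 1 * a

theorem stirlingLoss_pos (a : ℕ) : 0 < stirlingLoss a := by
  unfold stirlingLoss
  split_ifs with h
  · exact one_pos
  · have : (0 : ℝ) < a := by exact_mod_cast Nat.pos_of_ne_zero h
    positivity

theorem factorial_le_stirlingLoss_mul (a : ℕ) :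
    (a.factorial : ℝ) ≤ stirlingLoss a * a ^ a * Real.exp (-a) := by
  unfold stirlingLoss
  split_ifs with h
  · simp [h]
  · exact factorial_le_exp_one_mul a h

section Dense

variable {G : Type*} [AddCommGroup G] [Fintype G] [DecidableEq G] {e : G → G → ℝ}

omit [AddCommGroup G] [DecidableEq G] in
theorem prod_factorial_le (a : G → ℕ) (ha : ∑ c, a c = Fintype.card G) :
    ∏ c, ((a c).factorial : ℝ)
      ≤ (Fintype.card G).factorial * ((∏ c, stirlingLoss (a c)) * fiberDensity G a) := by
  rcases isEmpty_or_nonempty G with hG | hG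
  · simp [fiberDensity]
  set N := Fintype.card G
  have hN : (0 : ℝ) < N := by exact_mod_cast Fintype.card_pos
  have hdens : fiberDensity G a = (∏ c, (a c : ℝ) ^ a c) / N ^ N := by
    unfold fiberDensity
    simp only [div_pow]
    rw [prod_div_distrib, prod_pow_eq_pow_sum, ha]
  have hsum : ∑ c, (a c : ℝ) = N := by exact_mod_cast ha
  have h1 : ∏ c, ((a c).factorial : ℝ)
      ≤ (∏ c, stirlingLoss (a c)) * (∏ c, (a c : ℝ) ^ a c) * Real.exp (-N) := by
    refine (prod_le_prod (fun _ _ => by positivity) fun c _ =>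
      factorial_le_stirlingLoss_mul (a c)).trans_eq ?_
    rw [prod_mul_distrib, prod_mul_distrib, ← Real.exp_sum, sum_neg_distrib, hsum]
  have h2 : Real.exp (-N) ≤ (N.factorial : ℝ) / N ^ N := by
    have := Real.pow_div_factorial_le_exp (N : ℝ) hN.le N
    rw [Real.exp_neg, inv_eq_one_div, div_le_div_iff₀ (Real.exp_pos _) (by positivity), one_mul]
    rwa [div_le_iff₀ (by positivity), mul_comm] at this
  have hpos : 0 ≤ ∏ c, stirlingLoss (a c) := prod_nonneg fun c _ => (stirlingLoss_pos _).le
  refine h1.trans ?_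
  rw [hdens]
  calc _ ≤ (∏ c, stirlingLoss (a c)) * (∏ c, (a c : ℝ) ^ a c) * ((N.factorial : ℝ) / N ^ N) := by
        gcongr
    _ = _ := by ring

/-- With `R` the density and `P` the product of the losses, the coefficient bound and Stirling give
`M ^ 2 ≤ P ^ 2 * R`; there are at most `1 / R` rearrangements, so one factor `R` is left over. -/
theorem sum_fiberCard_eq_permMean_pow_four_le (he : IsSignPairing e) (α : G → G) :
    ∑ β with fiberCard β = fiberCard α, permMean e β ^ 4
      ≤ (∏ c, stirlingLoss (fiberCard α c)) ^ 4 * fiberDensity G (fiberCard α) := by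
  set R := fiberDensity G (fiberCard α) with hR
  set P := ∏ c, stirlingLoss (fiberCard α c) with hP
  set F := ∏ c, ((fiberCard α c).factorial : ℝ) with hF
  set f : ℝ := ((Fintype.card G).factorial : ℝ) with hf
  have hRpos : 0 < R := fiberDensity_pos _
  have hfpos : 0 < f := by positivity
  have hPpos : 0 < P := prod_pos fun c _ => stirlingLoss_pos _
  have hFpos : 0 < F := by positivity
  have h1 := factorial_mul_permMean (e := e) α
  have h2 := sq_sum_fiberCard_eq_mul_le he α
  have h3 := prod_factorial_le _ (sum_fiberCard α)
  have h4 := card_fiberCard_eq_mul_fiberDensity_le α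
  set s := ∑ β with fiberCard β = fiberCard α, ∏ x, e (β x) x
  set M := permMean e α
  rw [← hF, ← hf] at h1
  rw [← hF, ← hf, ← hP, ← hR] at h3
  rw [← hR] at h2 h4
  rw [sum_congr rfl fun β hβ => by rw [permMean_eq_of_fiberCard_eq (mem_filter.1 hβ).2],
    sum_const, nsmul_eq_mul]
  set n : ℝ := ((univ.filter fun β => fiberCard β = fiberCard α).card : ℝ)
  have h5 : M ^ 2 ≤ P ^ 2 * R := by
    have h6 : f ^ 2 * M ^ 2 * R ≤ f ^ 2 * (P ^ 2 * R) * R := by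
      calc f ^ 2 * M ^ 2 * R = F ^ 2 * (s ^ 2 * R) := by rw [← mul_pow, h1]; ring
        _ ≤ F ^ 2 * 1 := by gcongr
        _ ≤ (f * (P * R)) ^ 2 * 1 := by gcongr
        _ = _ := by ring
    rw [mul_assoc, mul_assoc, mul_le_mul_iff_right₀ (by positivity)] at h6
    exact le_of_mul_le_mul_right h6 hRpos
  calc n * M ^ 4 = n * (M ^ 2) ^ 2 := by ring
    _ ≤ n * (P ^ 2 * R) ^ 2 := by gcongr
    _ = P ^ 4 * R * (n * R) := by ring
    _ ≤ P ^ 4 * R * 1 := by gcongr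
    _ = _ := mul_one _

/-- The constant governing the contribution of the dense characters. -/
noncomputable def denseConst : ℝ :=
  5 / 4 * Real.exp 1 ^ 4 * ∑' b : ℕ, (b : ℝ) ^ 5 * (22 / 25) ^ b

theorem sum_stirlingLoss_le (N : ℕ) (hN : 0 < N) :
    ∑ b ∈ range (N + 1) with 5 * b ≤ 4 * N,
        stirlingLoss b ^ 4 * ((b : ℝ) / N) ^ b * (11 / 10) ^ b
      ≤ 1 + denseConst / N := by
  have hN' : (0 : ℝ) < N := by exact_mod_cast hN
  have hsummable : Summable fun b : ℕ => (b : ℝ) ^ 5 * (22 / 25) ^ b :=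
    summable_pow_mul_geometric_of_norm_lt_one 5 (by norm_num)
  have h0 : 0 ∈ (range (N + 1)).filter fun b => 5 * b ≤ 4 * N := by simp
  rw [← add_sum_erase _ _ h0]
  refine add_le_add (by simp [stirlingLoss]) ?_
  have hterm : ∀ b ∈ ((range (N + 1)).filter fun b => 5 * b ≤ 4 * N).erase 0,
      stirlingLoss b ^ 4 * ((b : ℝ) / N) ^ b * (11 / 10) ^ b
        ≤ 5 / 4 * Real.exp 1 ^ 4 / N * ((b : ℝ) ^ 5 * (22 / 25) ^ b) := by
    intro b hb
    simp only [mem_erase, mem_filter] at hb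
    obtain ⟨hb0, -, hb1⟩ := hb
    obtain ⟨j, rfl⟩ := Nat.exists_eq_succ_of_ne_zero hb0
    have hle : ((j.succ : ℕ) : ℝ) / N * (11 / 10) ≤ 22 / 25 := by
      have : (5 : ℝ) * (j.succ : ℕ) ≤ 4 * N := by exact_mod_cast hb1
      rw [div_mul_eq_mul_div, div_le_iff₀ hN']
      linarith
    -- One of the `b` factors `(b / N) * (11 / 10)` is kept apart to supply `1 / N`; the others are
    -- at most `22 / 25`. The constant `5 / 4` is `(11 / 10) / (22 / 25)`.
    rw [stirlingLoss, if_neg hb0, mul_assoc _ (_ ^ _) (_ ^ _), ← mul_pow, pow_succ _ j]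
    calc _ ≤ (Real.exp 1 * (j.succ : ℕ)) ^ 4 *
          ((22 / 25) ^ j * (((j.succ : ℕ) : ℝ) / N * (11 / 10))) := by gcongr
      _ = _ := by rw [Nat.succ_eq_add_one, pow_succ (22 / 25 : ℝ) j]; ring
  refine (sum_le_sum hterm).trans ?_
  rw [← mul_sum, denseConst]
  have := hsummable.sum_le_tsum
    (((range (N + 1)).filter fun b => 5 * b ≤ 4 * N).erase 0) (fun b _ => by positivity)
  calc _ ≤ 5 / 4 * Real.exp 1 ^ 4 / N * ∑' b : ℕ, (b : ℝ) ^ 5 * (22 / 25) ^ b := by gcongr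
    _ = _ := by ring

theorem sum_dense_permMean_pow_four_le (he : IsSignPairing e) :
    ∑ α : G → G with ∀ c, 5 * fiberCard α c ≤ 4 * Fintype.card G, permMean e α ^ 4
      ≤ 10 * Real.exp denseConst / Fintype.card G := by
  set N := Fintype.card G with hN
  have hNpos : 0 < N := Fintype.card_pos
  have hN' : (0 : ℝ) < N := by exact_mod_cast hNpos
  set B := (range (N + 1)).filter fun b => 5 * b ≤ 4 * N with hB
  -- Fibre sizes add up to `N`, so weighting by `y ^ a c` costs nothing but the factor `y ^ N`,
  -- whose inverse is at most `10 / N`. Dropping that constraint afterwards makes the sum over types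
  -- a product of `N` equal factors `1 + O(1/N)`; convergence needs `4 / 5 * y < 1`.
  set y : ℝ := 11 / 10 with hy
  have hstep : ∑ α : G → G with ∀ c, 5 * fiberCard α c ≤ 4 * N, permMean e α ^ 4
      ≤ ∑ a ∈ Fintype.piFinset fun _ : G => B,
        (∏ c, (stirlingLoss (a c) ^ 4 * ((a c : ℝ) / N) ^ a c * y ^ a c)) * (y ^ N)⁻¹ := by
    rw [← sum_fiberwise_of_maps_to
      (s := univ.filter fun α : G → G => ∀ c, 5 * fiberCard α c ≤ 4 * N)
      (t := Fintype.piFinset fun _ : G => B) (g := fiberCard)]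
    · refine sum_le_sum fun a _ => ?_
      have hnn : 0 ≤ (∏ c, (stirlingLoss (a c) ^ 4 * ((a c : ℝ) / N) ^ a c * y ^ a c))
          * (y ^ N)⁻¹ := by
        refine mul_nonneg (prod_nonneg fun c _ => ?_) (by positivity)
        have := stirlingLoss_pos (a c)
        positivity
      by_cases hex : ∃ α : G → G, fiberCard α = a
      · obtain ⟨α, rfl⟩ := hex
        refine (sum_le_sum_of_subset_of_nonneg (t := univ.filter fun β =>
          fiberCard β = fiberCard α) ?_ fun _ _ _ => by positivity).trans
          ((sum_fiberCard_eq_permMean_pow_four_le he α).trans_eq ?_)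
        · intro β hβ
          simp only [mem_filter, mem_univ, true_and] at hβ ⊢
          exact hβ.2
        · rw [prod_mul_distrib, prod_mul_distrib, prod_pow_eq_pow_sum, sum_fiberCard, ← hN,
            mul_assoc, mul_inv_cancel₀ (by positivity), mul_one, prod_pow, fiberDensity]
      · rw [filter_false_of_mem, sum_empty]
        · exact hnn
        · rintro β - hβ
          exact hex ⟨β, hβ⟩
    · intro α hα
      rw [Fintype.mem_piFinset]
      intro c
      rw [hB, mem_filter, mem_range]
      exact ⟨Nat.lt_succ_of_le (fiberCard_le α c), (mem_filter.1 hα).2 c⟩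
  refine hstep.trans ?_
  rw [← sum_mul, ← prod_univ_sum (fun _ : G => B)
    (fun _ b => stirlingLoss b ^ 4 * ((b : ℝ) / N) ^ b * y ^ b), prod_const, card_univ, ← hN]
  have h1 := sum_stirlingLoss_le N hNpos
  have h0 : 0 ≤ ∑ b ∈ B, stirlingLoss b ^ 4 * ((b : ℝ) / N) ^ b * y ^ b :=
    sum_nonneg fun b _ => by
      have := stirlingLoss_pos b
      positivity
  have h2 : (∑ b ∈ B, stirlingLoss b ^ 4 * ((b : ℝ) / N) ^ b * y ^ b) ^ N
      ≤ Real.exp denseConst := by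
    calc _ ≤ (Real.exp (denseConst / N)) ^ N := by
          refine pow_le_pow_left₀ h0 (h1.trans ?_) N
          linarith [Real.add_one_le_exp (denseConst / N)]
      _ = _ := by
          rw [← Real.exp_nat_mul, mul_div_cancel₀ _ hN'.ne']
  have h3 : (N : ℝ) / 10 ≤ y ^ N := by
    have := one_add_mul_le_pow (show (-2 : ℝ) ≤ 1 / 10 by norm_num) N
    have hy' : (1 + 1 / 10 : ℝ) = y := by norm_num [hy]
    rw [hy'] at this
    linarith
  calc _ ≤ Real.exp denseConst * (N / 10 : ℝ)⁻¹ := by gcongr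
    _ = _ := by field_simp

end Dense

/-! ### The fourth moment of the Fourier coefficients -/

section FourthMoment

variable {G : Type*} [AddCommGroup G] [Fintype G] [DecidableEq G] {e : G → G → ℝ}

theorem card_nonzeroSet_sub_const (α : G → G) (c : G) :
    (nonzeroSet fun x => α x + -c).card + fiberCard α c = Fintype.card G := by
  have h := card_filter_add_card_filter_not (s := (univ : Finset G)) (fun x => α x = c)
  rw [card_univ] at h
  rw [← h, fiberCard, add_comm]
  congr 2
  ext x
  simp [add_neg_eq_zero]

theorem sum_permMean_pow_four_vanishing_le (he : IsSignPairing e)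
    (hsymm : ∀ γ δ : G, γ + δ = 0 ↔ γ = δ) (x₀ : G) :
    ∑ α : G → G with α ≠ 0 ∧ α x₀ = 0, permMean e α ^ 4
      ≤ (10 * Real.exp denseConst + 20) / Fintype.card G := by
  set N := Fintype.card G with hN
  have hNpos : (0 : ℝ) < N := by exact_mod_cast (Fintype.card_pos : 0 < Fintype.card G)
  rw [← sum_filter_add_sum_filter_not _ fun α => ∀ c, 5 * fiberCard α c ≤ 4 * N, add_div]
  refine add_le_add ((sum_le_sum_of_subset_of_nonneg ?_ fun _ _ _ => by positivity).trans
    (sum_dense_permMean_pow_four_le he)) ?_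
  · intro α hα
    simp only [mem_filter, mem_univ, true_and] at hα ⊢
    exact hα.2
  -- `v α` will be the dominant value of `α`; the value 0 in the dense case is never used.
  have hex : ∀ α : G → G, ∃ c, (¬ ∀ c, 5 * fiberCard α c ≤ 4 * N) → 4 * N < 5 * fiberCard α c := by
    intro α
    by_cases h : ∀ c, 5 * fiberCard α c ≤ 4 * N
    · exact ⟨0, fun h' => absurd h h'⟩
    · push Not at h
      obtain ⟨c, hc⟩ := h
      exact ⟨c, fun _ => hc⟩
  choose v hv using hex
  set A := (univ.filter fun α : G → G => α ≠ 0 ∧ α x₀ = 0).filter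
    fun α => ¬ ∀ c, 5 * fiberCard α c ≤ 4 * N with hA
  set φ : (G → G) → G → G := fun α x => α x + -v α with hφ
  -- Since `α x₀ = 0`, the shifted function shows at `x₀` how far it was shifted.
  have hinj : Set.InjOn φ A := by
    intro α hα β hβ h
    simp only [hA, coe_filter, mem_filter, mem_univ, true_and, Set.mem_ofPred_eq] at hα hβ
    have h0 := congrFun h x₀
    simp only [hφ, hα.1.2, hβ.1.2, zero_add, neg_inj] at h0
    funext x
    have hx := congrFun h x
    simp only [hφ, h0, add_left_inj] at hx
    exact hx
  have hval : ∀ α, permMean e α ^ 4 = permMean e (φ α) ^ 4 := by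
    intro α
    have := sq_permMean_add_const he α (-v α)
    rw [show 4 = 2 * 2 from rfl, pow_mul, pow_mul, ← this]
  rw [sum_congr rfl fun α _ => hval α, ← sum_image (f := fun β => permMean e β ^ 4) hinj]
  have hs := sum_sparse_permMean_pow_four_le he hsymm univ
  rw [← hN, card_univ, ← hN] at hs
  refine (sum_le_sum_of_subset_of_nonneg ?_ fun _ _ _ => by positivity).trans
    (hs.trans_eq ?_)
  · intro β hβ
    obtain ⟨α, hα, rfl⟩ := mem_image.1 hβ
    simp only [hA, mem_filter, mem_univ, true_and] at hα ⊢
    have h1 := hv α hα.2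
    have h2 := card_nonzeroSet_sub_const α (v α)
    refine ⟨fun h => hα.1.1 ?_, subset_univ _, ?_⟩
    · have h3 : ∀ x, α x = v α := fun x => by
        have := congrFun h x
        simpa [hφ, add_neg_eq_zero] using this
      funext x
      rw [h3 x, ← h3 x₀, hα.1.2]
      rfl
    · change 5 * (nonzeroSet fun x => α x + -v α).card ≤ N
      omega
  · field_simp

/-- The constant in the bound for the fourth moment of the Fourier coefficients. -/
noncomputable def fourthMomentConst : ℝ := 25 * (10 * Real.exp denseConst + 20)

theorem fourthMomentConst_pos : 0 < fourthMomentConst := by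
  unfold fourthMomentConst
  positivity

theorem sum_permMean_pow_four_le (he : IsSignPairing e)
    (hsymm : ∀ γ δ : G, γ + δ = 0 ↔ γ = δ) (T : Finset G) (hT : T.card < Fintype.card G) :
    ∑ α : G → G with α ≠ 0 ∧ nonzeroSet α ⊆ T, permMean e α ^ 4
      ≤ fourthMomentConst * (T.card : ℝ) ^ 2 / (Fintype.card G : ℝ) ^ 3 := by
  set N := Fintype.card G with hN
  have hNpos : (0 : ℝ) < N := by exact_mod_cast (Fintype.card_pos : 0 < Fintype.card G)
  have hexp := Real.exp_pos denseConst
  by_cases h : 5 * T.card ≤ N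
  · have hs := sum_sparse_permMean_pow_four_le he hsymm T
    refine (sum_le_sum_of_subset_of_nonneg ?_ fun _ _ _ => by positivity).trans
      (hs.trans ?_)
    · intro α hα
      simp only [mem_filter, mem_univ, true_and] at hα ⊢
      exact ⟨hα.1, hα.2, by have := card_le_card hα.2; omega⟩
    · rw [fourthMomentConst]
      gcongr
      linarith
  -- The strict bound on `T.card` is needed here: without a place where `α` vanishes, all nonzero
  -- constants would count, each with `μ² = 1`.
  · obtain ⟨x₀, hx₀⟩ : ∃ x₀, x₀ ∉ T := by
      by_contra hcon
      push Not at hcon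
      rw [eq_univ_iff_forall.2 hcon, card_univ] at hT
      exact lt_irrefl _ hT
    refine (sum_le_sum_of_subset_of_nonneg ?_ fun _ _ _ => by positivity).trans
      ((sum_permMean_pow_four_vanishing_le he hsymm x₀).trans ?_)
    · intro α hα
      simp only [mem_filter, mem_univ, true_and] at hα ⊢
      refine ⟨hα.1, ?_⟩
      by_contra hne
      exact hx₀ (hα.2 (mem_nonzeroSet.2 hne))
    · have h1 : (N : ℝ) ≤ 5 * T.card := by exact_mod_cast (not_le.1 h).le
      have h2 : (N : ℝ) ^ 2 ≤ 25 * (T.card : ℝ) ^ 2 := by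
        calc (N : ℝ) ^ 2 ≤ (5 * T.card) ^ 2 := by gcongr
          _ = _ := by ring
      rw [← hN, fourthMomentConst, div_le_div_iff₀ hNpos (by positivity)]
      calc _ = (10 * Real.exp denseConst + 20) * N * (N : ℝ) ^ 2 := by ring
        _ ≤ (10 * Real.exp denseConst + 20) * N * (25 * (T.card : ℝ) ^ 2) := by gcongr
        _ = _ := by ring

end FourthMoment

/-! ### Acceptance probabilities and simulation of answers -/

namespace OracleAlg

variable {X Y : Type}

/-- The probability that `A` outputs `1` with the oracle `f`. -/
noncomputable def prob (f : X → Y) (A : OracleAlg X Y) : ℝ := (A.run f true).toReal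

theorem prob_nonneg (f : X → Y) (A : OracleAlg X Y) : 0 ≤ A.prob f := ENNReal.toReal_nonneg

theorem prob_le_one (f : X → Y) (A : OracleAlg X Y) : A.prob f ≤ 1 :=
  ENNReal.toReal_le_of_le_ofReal zero_le_one (by simpa using (A.run f).coe_le_one true)

theorem hasSum_toReal_pmf (μ : PMF ℕ) : HasSum (fun i => (μ i).toReal) 1 := by
  have h := ENNReal.hasSum_toReal (f := fun i => μ i) (by rw [μ.tsum_coe]; simp)
  rwa [← ENNReal.tsum_toReal_eq fun i => μ.apply_ne_top i, μ.tsum_coe, ENNReal.toReal_one] at h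

theorem summable_pmf_mul_prob (μ : PMF ℕ) (next : ℕ → OracleAlg X Y) (f : X → Y) :
    Summable fun i => (μ i).toReal * (next i).prob f :=
  (hasSum_toReal_pmf μ).summable.of_nonneg_of_le
    (fun _ => mul_nonneg ENNReal.toReal_nonneg (prob_nonneg f _))
    fun _ => mul_le_of_le_one_right ENNReal.toReal_nonneg (prob_le_one f _)

theorem prob_sample (μ : PMF ℕ) (next : ℕ → OracleAlg X Y) (f : X → Y) :
    (sample μ next).prob f = ∑' i, (μ i).toReal * (next i).prob f := by
  rw [prob, run, PMF.bind_apply, ENNReal.tsum_toReal_eq fun i =>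
    ENNReal.mul_ne_top (μ.apply_ne_top i) (((next i).run f).apply_ne_top true)]
  simp only [ENNReal.toReal_mul, prob]

theorem acceptProb_eq {S : Type*} [Fintype S] [Nonempty S] (F : S → X → Y) (A : OracleAlg X Y) :
    acceptProb F A = (∑ s, A.prob (F s)) / Fintype.card S := by
  rw [acceptProb, PMF.bind_apply, tsum_fintype, ENNReal.toReal_sum fun s _ =>
    ENNReal.mul_ne_top (PMF.apply_ne_top _ _) (PMF.apply_ne_top _ _), sum_div]
  refine sum_congr rfl fun s _ => ?_
  rw [ENNReal.toReal_mul, PMF.uniformOfFintype_apply, prob]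
  simp
  ring

theorem QueriesAtMost.succ {A : OracleAlg X Y} : ∀ {m : ℕ}, A.QueriesAtMost m →
    A.QueriesAtMost (m + 1) := by
  induction A with
  | output b => intros; trivial
  | query x next ih =>
    intro m h
    match m, h with
    | m + 1, h => exact fun y => ih y (h y)
  | sample μ next ih =>
    intro m h i
    simp only [QueriesAtMost] at h
    exact ih i (h i)

/-- The algorithm that simulates `A`, transforming the answer `y` at the place `x` to `h x y`. -/
def mapAnswers (h : X → Y → Y) : OracleAlg X Y → OracleAlg X Y
  | output b => output b
  | query x next => query x fun y => mapAnswers h (next (h x y))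
  | sample μ next => sample μ fun i => mapAnswers h (next i)

theorem run_mapAnswers (h : X → Y → Y) (f : X → Y) (A : OracleAlg X Y) :
    (A.mapAnswers h).run f = A.run fun x => h x (f x) := by
  induction A with
  | output b => rfl
  | query x next ih => exact ih (h x (f x))
  | sample μ next ih => simp only [mapAnswers, run, ih]

theorem QueriesAtMost.mapAnswers {A : OracleAlg X Y} (h : X → Y → Y) :
    ∀ {m : ℕ}, A.QueriesAtMost m → (A.mapAnswers h).QueriesAtMost m := by
  induction A with
  | output b => intros; trivial
  | query x next ih =>
    intro m hm
    match m, hm with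
    | m + 1, hm => exact fun y => ih (h x y) (hm (h x y))
  | sample μ next ih =>
    intro m hm
    simp only [QueriesAtMost, OracleAlg.mapAnswers] at hm ⊢
    exact fun i => ih i (hm i)

end OracleAlg

/-! ### Adaptive algorithms against symmetric signed measures -/

section Transcripts

variable {X Y : Type} [Fintype X] [DecidableEq X] [Fintype Y] [DecidableEq Y]

/-- The sum of the absolute values of `w` over all extensions of `y` by `j` further answers. -/
def leafSum (w : List Y → ℝ) : ℕ → List Y → ℝ
  | 0, y => |w y|
  | j + 1, y => ∑ v, leafSum w j (v :: y)

/-- The sum of the squares of `w` over all extensions of `y` by `j` further answers. -/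
def leafSqSum (w : List Y → ℝ) : ℕ → List Y → ℝ
  | 0, y => w y ^ 2
  | j + 1, y => ∑ v, leafSqSum w j (v :: y)

omit [DecidableEq Y] in
theorem leafSum_nonneg (w : List Y → ℝ) (j : ℕ) : ∀ y, 0 ≤ leafSum w j y := by
  induction j with
  | zero => exact fun y => abs_nonneg _
  | succ j ih => exact fun y => sum_nonneg fun v _ => ih _

omit [DecidableEq Y] in
theorem sq_leafSum_le (w : List Y → ℝ) (j : ℕ) :
    ∀ y, leafSum w j y ^ 2 ≤ (Fintype.card Y : ℝ) ^ j * leafSqSum w j y := by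
  induction j with
  | zero => intro y; simp [leafSum, leafSqSum]
  | succ j ih =>
    intro y
    rw [leafSum, leafSqSum, pow_succ' _ j, mul_assoc, mul_sum]
    refine sq_sum_le_card_mul_sum_sq.trans ?_
    rw [card_univ]
    exact mul_le_mul_of_nonneg_left (sum_le_sum fun v _ => ih _) (by positivity)

/-- `w` gives the marginals of the signed measure `W` at every list of distinct places. -/
def IsMarginal (W : (X → Y) → ℝ) (w : List Y → ℝ) : Prop :=
  ∀ x : List X, x.Nodup → ∀ y : List Y, y.length = x.length → ∑ f with x.map f = y, W f = w y

theorem sum_map_eq_split (W : (X → Y) → ℝ) (x : List X) (y : List Y) (x₀ : X) :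
    ∑ f with x.map f = y, W f = ∑ v, ∑ f with (x₀ :: x).map f = v :: y, W f := by
  rw [← sum_fiberwise _ (fun f : X → Y => f x₀)]
  refine sum_congr rfl fun v _ => sum_congr ?_ fun _ _ => rfl
  ext f
  simp [and_comm]

theorem abs_le_leafSum {W : (X → Y) → ℝ} {w : List Y → ℝ} (h : IsMarginal W w) (j : ℕ) :
    ∀ x : List X, ∀ y : List Y, x.Nodup → y.length = x.length → x.length + j ≤ Fintype.card X →
      |w y| ≤ leafSum w j y := by
  induction j with
  | zero => intros; exact le_rfl
  | succ j ih =>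
    intro x y hx hy hj
    obtain ⟨x₀, hx₀⟩ : ∃ x₀, x₀ ∉ x := by
      by_contra hcon
      push Not at hcon
      have h1 : x.toFinset = univ := eq_univ_iff_forall.2 fun a => List.mem_toFinset.2 (hcon a)
      have h2 := List.toFinset_card_of_nodup hx
      rw [h1, card_univ] at h2
      omega
    have hx' : (x₀ :: x).Nodup := List.nodup_cons.2 ⟨hx₀, hx⟩
    have hw : w y = ∑ v, w (v :: y) := by
      rw [← h x hx y hy, sum_map_eq_split W x y x₀]
      exact sum_congr rfl fun v _ => h _ hx' _ (by simp [hy])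
    rw [hw, leafSum]
    refine (abs_sum_le_sum_abs _ _).trans (sum_le_sum fun v _ => ?_)
    exact ih (x₀ :: x) (v :: y) hx' (by simp [hy]) (by simp only [List.length_cons]; omega)

/-- An adaptive algorithm cannot do better than comparing the marginals. -/
theorem abs_sum_mul_prob_le_leafSum {W : (X → Y) → ℝ} {w : List Y → ℝ} (h : IsMarginal W w)
    (A : OracleAlg X Y) :
    ∀ (j : ℕ) (x : List X) (y : List Y), x.Nodup → y.length = x.length →
      x.length + j ≤ Fintype.card X → A.QueriesAtMost j →
      |∑ f with x.map f = y, W f * A.prob f| ≤ leafSum w j y := by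
  induction A with
  | output b =>
    intro j x y hx hy hj _
    rcases isEmpty_or_nonempty (X → Y) with he | ⟨⟨f₀⟩⟩
    · rw [sum_of_isEmpty, abs_zero]
      exact leafSum_nonneg _ _ _
    have h1 : ∑ f with x.map f = y, W f * (OracleAlg.output b : OracleAlg X Y).prob f
        = w y * (OracleAlg.output b : OracleAlg X Y).prob f₀ := by
      rw [← h x hx y hy, sum_mul]
      rfl
    rw [h1, abs_mul, abs_of_nonneg (OracleAlg.prob_nonneg _ _)]
    exact (mul_le_of_le_one_right (abs_nonneg _) (OracleAlg.prob_le_one _ _)).trans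
      (abs_le_leafSum h j x y hx hy hj)
  | query x₀ next ih =>
    intro j x y hx hy hj hq
    match j, hj, hq with
    | j + 1, hj, hq =>
    have hprob : ∀ f : X → Y, (OracleAlg.query x₀ next).prob f = (next (f x₀)).prob f :=
      fun f => rfl
    simp only [hprob]
    -- A repeated query has an answer already fixed by the transcript, so the algorithm continues
    -- with the same places and an unspent query; a new place extends the transcript.
    by_cases hmem : x₀ ∈ x
    · by_cases hex : ∃ f₀ : X → Y, x.map f₀ = y
      · obtain ⟨f₀, hf₀⟩ := hex
        have hval : ∀ f : X → Y, x.map f = y → f x₀ = f₀ x₀ := fun f hf =>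
          List.map_inj_left.1 (hf.trans hf₀.symm) x₀ hmem
        rw [sum_congr rfl fun f hf => by rw [hval f (mem_filter.1 hf).2]]
        exact ih _ (j + 1) x y hx hy hj (hq _).succ
      · rw [filter_false_of_mem fun f _ hf => hex ⟨f, hf⟩, sum_empty, abs_zero]
        exact leafSum_nonneg _ _ _
    · rw [sum_map_eq_split _ x y x₀, leafSum]
      refine (abs_sum_le_sum_abs _ _).trans (sum_le_sum fun v _ => ?_)
      rw [sum_congr rfl fun f hf => by
        rw [show f x₀ = v from (List.cons_eq_cons.1 (mem_filter.1 hf).2).1]]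
      exact ih v j (x₀ :: x) (v :: y) (List.nodup_cons.2 ⟨hmem, hx⟩) (by simp [hy])
        (by simp only [List.length_cons]; omega) (hq v)
  | sample μ next ih =>
    intro j x y hx hy hj hq
    simp only [OracleAlg.QueriesAtMost] at hq
    have hsum : ∑ f with x.map f = y, W f * (OracleAlg.sample μ next).prob f
        = ∑' i, (μ i).toReal * ∑ f with x.map f = y, W f * (next i).prob f := by
      simp only [OracleAlg.prob_sample, ← tsum_mul_left]
      rw [← Summable.tsum_finsetSum fun f _ =>
        (OracleAlg.summable_pmf_mul_prob μ next f).mul_left (W f)]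
      refine tsum_congr fun i => ?_
      rw [mul_sum]
      exact sum_congr rfl fun f _ => by ring
    have hμ := OracleAlg.hasSum_toReal_pmf μ
    have hbound : ∀ i, ‖(μ i).toReal * ∑ f with x.map f = y, W f * (next i).prob f‖
        ≤ (μ i).toReal * leafSum w j y := by
      intro i
      rw [norm_mul, Real.norm_eq_abs, Real.norm_eq_abs, abs_of_nonneg ENNReal.toReal_nonneg]
      exact mul_le_mul_of_nonneg_left (ih i j x y hx hy hj (hq i)) ENNReal.toReal_nonneg
    rw [hsum, ← Real.norm_eq_abs]
    have := tsum_of_norm_bounded (hμ.mul_right (leafSum w j y)) hbound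
    rwa [one_mul] at this

/-- Squaring a marginal counts pairs of functions that agree on the places, the form in which
Parseval applies. -/
theorem leafSqSum_eq {W : (X → Y) → ℝ} {w : List Y → ℝ} (h : IsMarginal W w) (x' : List X) :
    ∀ (x : List X) (y : List Y), (x' ++ x).Nodup → y.length = x.length →
      leafSqSum w x'.length y
        = ∑ f with x.map f = y, ∑ g with x.map g = y ∧ x'.map f = x'.map g, W f * W g := by
  induction x' with
  | nil =>
    intro x y hx hy
    simp only [List.length_nil, leafSqSum, List.map_nil, and_true]
    rw [← h x hx y hy, sq, sum_mul_sum]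
  | cons p x' ih =>
    intro x y hx hy
    have hperm : (x' ++ p :: x).Nodup := by
      rw [List.nodup_middle]
      exact hx
    rw [List.length_cons, leafSqSum, sum_congr rfl fun v _ =>
      ih (p :: x) (v :: y) hperm (by simp [hy]), sum_map_eq_split _ x y p]
    refine sum_congr rfl fun v _ => sum_congr rfl fun f hf => sum_congr ?_ fun _ _ => rfl
    have hfp : f p = v := (List.cons_eq_cons.1 (mem_filter.1 hf).2).1
    ext g
    simp only [mem_filter, mem_univ, true_and, List.map_cons, List.cons_eq_cons, hfp]
    tauto

omit [Fintype X] [DecidableEq X] in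
theorem exists_perm_map_eq {x x' : List X} (hx : x.Nodup) (hx' : x'.Nodup)
    (h : x.length = x'.length) : ∃ σ : Equiv.Perm X, x.map σ = x' := by
  have hpre := Equiv.Perm.isMultiplyPretransitive X x.length
  let i : Fin x.length ↪ X := ⟨x.get, List.nodup_iff_injective_get.1 hx⟩
  let i' : Fin x.length ↪ X :=
    ⟨fun k => x'.get (k.cast h), (List.nodup_iff_injective_get.1 hx').comp (Fin.cast_injective h)⟩
  obtain ⟨σ, hσ⟩ := MulAction.exists_smul_eq (Equiv.Perm X) i i'
  refine ⟨σ, List.ext_get (by simp [h]) fun n h1 h2 => ?_⟩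
  have := congrArg (fun j : Fin x.length ↪ X => j ⟨n, by simpa using h1⟩) hσ
  simpa [i, i'] using this

/-- Any two lists of distinct places of equal length are related by a permutation, so one reference
list for each length suffices. -/
theorem exists_isMarginal {W : (X → Y) → ℝ} (hW : ∀ f (σ : Equiv.Perm X), W (f ∘ σ) = W f) :
    ∃ w, IsMarginal W w := by
  refine ⟨fun y => ∑ f with ((univ : Finset X).toList.take y.length).map f = y, W f, ?_⟩
  intro x hx y hy
  have hle : x.length ≤ (univ : Finset X).toList.length := by
    rw [length_toList, ← List.toFinset_card_of_nodup hx]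
    exact card_le_univ _
  obtain ⟨σ, hσ⟩ := exists_perm_map_eq hx
    ((univ : Finset X).nodup_toList.sublist (List.take_sublist y.length _))
    (by rw [List.length_take, hy, min_eq_left hle])
  refine sum_nbij' (fun f => f ∘ σ.symm) (fun f => f ∘ σ) ?_ ?_ ?_ ?_ ?_
  · intro f hf
    simp only [mem_filter, mem_univ, true_and] at hf ⊢
    rw [← hσ, List.map_map, Function.comp_assoc]
    simpa using hf
  · intro f hf
    simp only [mem_filter, mem_univ, true_and] at hf ⊢
    rw [← List.map_map, hσ, hf]
  · intro f _
    funext a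
    simp
  · intro f _
    funext a
    simp
  · intro f _
    exact (hW f σ.symm).symm

end Transcripts

/-! ### The sum of two uniform permutations against a uniform function -/

section PermSum

variable {G : Type} [AddCommGroup G] [Fintype G] [DecidableEq G] {e : G → G → ℝ}

/-- The difference between the law of the sum of two independent uniform permutations and the
uniform law on functions. -/
noncomputable def permSumDeviation (f : G → G) : ℝ :=
  ((univ.filter fun p : Equiv.Perm G × Equiv.Perm G => (fun x => p.1 x + p.2 x) = f).card : ℝ)
    / ((Fintype.card G).factorial : ℝ) ^ 2 - 1 / (Fintype.card G : ℝ) ^ Fintype.card G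

theorem permSumDeviation_comp (f : G → G) (σ : Equiv.Perm G) :
    permSumDeviation (f ∘ σ) = permSumDeviation f := by
  unfold permSumDeviation
  congr 3
  refine card_nbij' (fun p => (p.1 * σ.symm, p.2 * σ.symm)) (fun p => (p.1 * σ, p.2 * σ))
    ?_ ?_ ?_ ?_
  · intro p hp
    simp only [coe_filter, mem_univ, true_and, Set.mem_ofPred_eq] at hp ⊢
    funext x
    simpa using congrFun hp (σ.symm x)
  · intro p hp
    simp only [coe_filter, mem_univ, true_and, Set.mem_ofPred_eq] at hp ⊢
    funext x
    simpa using congrFun hp (σ x)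
  · intro p _
    ext x <;> simp
  · intro p _
    ext x <;> simp

theorem sum_permSumDeviation_mul (h : (G → G) → ℝ) :
    ∑ f, permSumDeviation f * h f
      = (∑ p : Equiv.Perm G × Equiv.Perm G, h fun x => p.1 x + p.2 x)
          / ((Fintype.card G).factorial : ℝ) ^ 2
        - (∑ f, h f) / (Fintype.card G : ℝ) ^ Fintype.card G := by
  simp only [permSumDeviation, sub_mul, sum_sub_distrib]
  congr 1
  · rw [← sum_fiberwise univ
      (fun p : Equiv.Perm G × Equiv.Perm G => fun x => p.1 x + p.2 x), sum_div]
    refine sum_congr rfl fun f _ => ?_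
    rw [sum_congr rfl fun p hp => by rw [(mem_filter.1 hp).2], sum_const, nsmul_eq_mul]
    ring
  · rw [← mul_sum]
    ring

/-- The coefficient of a convolution square is a square, and the uniform law only has the
coefficient at 0, which cancels. -/
theorem sum_permSumDeviation_mul_prod (he : IsSignPairing e) (α : G → G) :
    ∑ f, permSumDeviation f * ∏ x, e (α x) (f x) = if α = 0 then 0 else permMean e α ^ 2 := by
  have hN : (0 : ℝ) < Fintype.card G := by exact_mod_cast (Fintype.card_pos : 0 < Fintype.card G)
  have hfac : (0 : ℝ) < ((Fintype.card G).factorial : ℝ) := by positivity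
  have h1 : (∑ p : Equiv.Perm G × Equiv.Perm G, ∏ x, e (α x) (p.1 x + p.2 x))
      / ((Fintype.card G).factorial : ℝ) ^ 2 = permMean e α ^ 2 := by
    rw [permMean, div_pow, sq (∑ π : Equiv.Perm G, _), sum_mul_sum, Fintype.sum_prod_type]
    simp only [he.add_right, prod_mul_distrib]
  rw [sum_permSumDeviation_mul, h1]
  have h2 : ∑ f : G → G, ∏ x, e (α x) (f x) = ∏ x, ∑ v, e (α x) v := by
    rw [prod_univ_sum, Fintype.piFinset_univ]
  rw [h2]
  split_ifs with hα
  · subst hα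
    simp [permMean_zero he, he.zero_left]
  · obtain ⟨x, hx⟩ := Function.ne_iff.1 hα
    rw [prod_eq_zero (mem_univ x) (he.sum_right hx), zero_div, sub_zero]

theorem sum_nonzeroSet_subset_prod (he : IsSignPairing e) (T : Finset G) (f g : G → G) :
    ∑ α with nonzeroSet α ⊆ T, ∏ x, (e (α x) (f x) * e (α x) (g x))
      = if ∀ x ∈ T, f x = g x then (Fintype.card G : ℝ) ^ T.card else 0 := by
  have hset : (univ.filter fun α : G → G => nonzeroSet α ⊆ T)
      = Fintype.piFinset fun x => if x ∈ T then univ else {0} := by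
    ext α
    simp only [mem_filter, mem_univ, true_and, Fintype.mem_piFinset]
    refine ⟨fun h x => ?_, fun h x hx => ?_⟩
    · split_ifs with hx
      · exact mem_univ _
      · rw [mem_singleton]
        by_contra hne
        exact hx (h (mem_nonzeroSet.2 hne))
    · by_contra hxT
      have := h x
      rw [if_neg hxT, mem_singleton] at this
      exact mem_nonzeroSet.1 hx this
  rw [hset, ← prod_univ_sum (fun x => if x ∈ T then (univ : Finset G) else {0})
    (fun x a => e a (f x) * e a (g x))]
  have hfac : ∀ x, ∑ a ∈ (if x ∈ T then (univ : Finset G) else {0}), e a (f x) * e a (g x)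
      = if x ∈ T then (if f x = g x then (Fintype.card G : ℝ) else 0) else 1 := by
    intro x
    split_ifs with hx hfg
    · rw [he.orth_left, if_pos hfg]
    · rw [he.orth_left, if_neg hfg]
    · simp [he.zero_left]
  rw [prod_congr rfl fun x _ => hfac x, prod_ite_mem, univ_inter]
  split_ifs with h
  · rw [prod_congr rfl fun x hx => if_pos (h x hx), prod_const]
  · push Not at h
    obtain ⟨x, hx, hne⟩ := h
    exact prod_eq_zero hx (if_neg hne)

/-- Parseval for the marginal on `T`: summing the characters supported in `T` detects agreement on
`T`. -/
theorem card_pow_mul_sum_permSumDeviation (he : IsSignPairing e) (T : Finset G) :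
    (Fintype.card G : ℝ) ^ T.card * ∑ f : G → G, ∑ g with ∀ x ∈ T, f x = g x,
        permSumDeviation f * permSumDeviation g
      = ∑ α : G → G with α ≠ 0 ∧ nonzeroSet α ⊆ T, permMean e α ^ 4 := by
  have h1 : ∑ α : G → G with α ≠ 0 ∧ nonzeroSet α ⊆ T, permMean e α ^ 4
      = ∑ α with nonzeroSet α ⊆ T, (∑ f, permSumDeviation f * ∏ x, e (α x) (f x)) ^ 2 := by
    simp only [sum_permSumDeviation_mul_prod he]
    rw [sum_filter, sum_filter]
    refine sum_congr rfl fun α _ => ?_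
    by_cases h0 : α = 0 <;> by_cases h2 : nonzeroSet α ⊆ T <;> simp [h0, h2, ← pow_mul]
  have h2 : ∀ α : G → G, (∑ f, permSumDeviation f * ∏ x, e (α x) (f x)) ^ 2
      = ∑ f, ∑ g, permSumDeviation f * permSumDeviation g
        * ∏ x, (e (α x) (f x) * e (α x) (g x)) := by
    intro α
    rw [sq, sum_mul_sum]
    refine sum_congr rfl fun f _ => sum_congr rfl fun g _ => ?_
    rw [prod_mul_distrib]
    ring
  rw [h1]
  simp only [h2]
  rw [sum_comm, mul_sum]
  refine sum_congr rfl fun f _ => ?_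
  rw [sum_comm, mul_sum, sum_filter]
  refine sum_congr rfl fun g _ => ?_
  rw [← mul_sum, sum_nonzeroSet_subset_prod he]
  split_ifs
  · ring
  · ring

/-- The sum of two independent uniform permutations is hard to distinguish from a uniform
function. -/
theorem sq_acceptProb_permSum_sub_le (he : IsSignPairing e)
    (hsymm : ∀ γ δ : G, γ + δ = 0 ↔ γ = δ) {m : ℕ} (hm : m < Fintype.card G)
    (A : OracleAlg G G) (hA : A.QueriesAtMost m) :
    (OracleAlg.acceptProb (fun (p : Equiv.Perm G × Equiv.Perm G) x => p.1 x + p.2 x) A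
        - OracleAlg.acceptProb (fun f : G → G => f) A) ^ 2
      ≤ fourthMomentConst * (m : ℝ) ^ 2 / (Fintype.card G : ℝ) ^ 3 := by
  obtain ⟨w, hw⟩ := exists_isMarginal (W := permSumDeviation (G := G)) permSumDeviation_comp
  have h1 := abs_sum_mul_prob_le_leafSum hw A m [] [] List.nodup_nil rfl (by simpa using hm.le) hA
  simp only [List.map_nil, filter_true, sum_permSumDeviation_mul] at h1
  have hdiff : OracleAlg.acceptProb (fun (p : Equiv.Perm G × Equiv.Perm G) x => p.1 x + p.2 x) A
        - OracleAlg.acceptProb (fun f : G → G => f) A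
      = (∑ p : Equiv.Perm G × Equiv.Perm G, A.prob fun x => p.1 x + p.2 x)
          / ((Fintype.card G).factorial : ℝ) ^ 2
        - (∑ f : G → G, A.prob f) / (Fintype.card G : ℝ) ^ Fintype.card G := by
    rw [OracleAlg.acceptProb_eq, OracleAlg.acceptProb_eq, Fintype.card_prod, Fintype.card_perm,
      Fintype.card_fun]
    push_cast
    rw [sq]
  rw [← hdiff] at h1
  obtain ⟨T, -, hT⟩ := exists_subset_card_eq (s := (univ : Finset G)) (n := m) hm.le
  have hlen : T.toList.length = m := by rw [length_toList, hT]
  have h2 := sq_leafSum_le w m []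
  have h3 := leafSqSum_eq hw T.toList [] [] (by simpa using T.nodup_toList) rfl
  rw [hlen] at h3
  have h4 := card_pow_mul_sum_permSumDeviation he T
  have h5 := sum_permMean_pow_four_le he hsymm T (hT ▸ hm)
  rw [hT] at h4 h5
  have h6 : (Fintype.card G : ℝ) ^ m * leafSqSum w m []
      = ∑ α : G → G with α ≠ 0 ∧ nonzeroSet α ⊆ T, permMean e α ^ 4 := by
    rw [h3, ← h4]
    simp [List.map_inj_left]
  calc _ = |OracleAlg.acceptProb (fun (p : Equiv.Perm G × Equiv.Perm G) x => p.1 x + p.2 x) A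
        - OracleAlg.acceptProb (fun f : G → G => f) A| ^ 2 := (sq_abs _).symm
    _ ≤ leafSum w m [] ^ 2 := pow_le_pow_left₀ (abs_nonneg _) h1 2
    _ ≤ _ := h2.trans (h6.trans_le h5)

end PermSum

/-! ### The sign pairing on 𝐅₂^d -/

section Block

variable {d : ℕ}

/-- The characters of `𝐅₂^d`, indexed by `𝐅₂^d` through the standard scalar product. -/
noncomputable def blockSign (a x : Block d) : ℝ := ∏ i, if a i = 0 ∨ x i = 0 then 1 else -1

theorem blockSign_comm (a x : Block d) : blockSign a x = blockSign x a := by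
  simp only [blockSign, or_comm]

theorem blockSign_add_left (a b x : Block d) :
    blockSign (a + b) x = blockSign a x * blockSign b x := by
  have h : ∀ s t u : ZMod 2, (if s + t = 0 ∨ u = 0 then (1 : ℝ) else -1)
      = (if s = 0 ∨ u = 0 then 1 else -1) * (if t = 0 ∨ u = 0 then 1 else -1) := by
    intro s t u
    have h01 : ∀ s : ZMod 2, s = 0 ∨ s = 1 := by decide
    have h11 : (1 : ZMod 2) + 1 = 0 := by decide
    rcases h01 s with rfl | rfl <;> rcases h01 t with rfl | rfl <;>
      rcases h01 u with rfl | rfl <;> simp [h11]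
  simp only [blockSign, Pi.add_apply, h, prod_mul_distrib]

theorem block_add_eq_zero_iff (a b : Block d) : a + b = 0 ↔ a = b := by
  have h : ∀ s t : ZMod 2, s + t = 0 ↔ s = t := by decide
  simp [funext_iff, h]

theorem sum_blockSign (a : Block d) :
    ∑ x, blockSign a x = if a = 0 then (Fintype.card (Block d) : ℝ) else 0 := by
  have h1 : ∑ x : Block d, blockSign a x
      = ∏ i, ∑ t : ZMod 2, if a i = 0 ∨ t = 0 then (1 : ℝ) else -1 := by
    rw [prod_univ_sum, Fintype.piFinset_univ]
    rfl
  rw [h1]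
  split_ifs with h
  · subst h
    simp
  · obtain ⟨i, hi⟩ := Function.ne_iff.1 h
    refine prod_eq_zero (mem_univ i) ?_
    have hi' : a i ≠ 0 := hi
    have h2 : (univ : Finset (ZMod 2)) = {0, 1} := rfl
    simp [hi', h2]

theorem isSignPairing_blockSign : IsSignPairing (blockSign (d := d)) where
  mul_self a x := by
    rw [← blockSign_add_left, (block_add_eq_zero_iff a a).2 rfl]
    simp [blockSign]
  add_left := blockSign_add_left
  add_right a x y := by
    rw [blockSign_comm, blockSign_add_left, blockSign_comm x, blockSign_comm y]
  orth_left x y := by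
    simp only [blockSign_comm _ x, blockSign_comm _ y, ← blockSign_add_left, sum_blockSign,
      block_add_eq_zero_iff]
  orth_right a b := by
    simp only [← blockSign_add_left, sum_blockSign, block_add_eq_zero_iff]

end Block

/-! ### The hybrid argument and the conclusion -/

section Hybrid

variable {K : Type*} [Fintype K] [Nonempty K] {d : ℕ}

theorem acceptProb_prod_add {X Y : Type} [Add Y] {S T : Type*} [Fintype S] [Nonempty S]
    [Fintype T] [Nonempty T] (F : S → X → Y) (g : T → X → Y) (A : OracleAlg X Y) :
    OracleAlg.acceptProb (fun (p : S × T) x => F p.1 x + g p.2 x) A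
      = (∑ t, OracleAlg.acceptProb F (A.mapAnswers fun x y => y + g t x)) / Fintype.card T := by
  simp only [OracleAlg.acceptProb_eq, OracleAlg.prob, OracleAlg.run_mapAnswers,
    Fintype.sum_prod_type_right, Fintype.card_prod, Nat.cast_mul]
  rw [← sum_div, div_div]

/-- For each fixed `t`, adding `g t x` to the answers turns `A` into a PRP distinguisher with the
same number of queries; the difference is the average over `t`. -/
theorem abs_acceptProb_add_sub_le_prpAdvantage (E : K → Equiv.Perm (Block d)) {T : Type*}
    [Fintype T] [Nonempty T] (g : T → Block d → Block d) {m : ℕ}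
    (A : OracleAlg (Block d) (Block d)) (hA : A.QueriesAtMost m) :
    |OracleAlg.acceptProb (fun (p : K × T) x => E p.1 x + g p.2 x) A
        - OracleAlg.acceptProb (fun (p : Equiv.Perm (Block d) × T) x => p.1 x + g p.2 x) A|
      ≤ prpAdvantage E m := by
  have hT : (0 : ℝ) < Fintype.card T := by exact_mod_cast (Fintype.card_pos : 0 < Fintype.card T)
  rw [acceptProb_prod_add (fun s x => E s x), acceptProb_prod_add
    (fun (π : Equiv.Perm (Block d)) x => π x), ← sub_div, ← sum_sub_distrib, abs_div, abs_of_pos hT, div_le_iff₀ hT]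
  refine (abs_sum_le_sum_abs _ _).trans ?_
  calc _ ≤ ∑ _t : T, prpAdvantage E m := by
        refine sum_le_sum fun t _ => ?_
        exact (maxAdvantage_isLUB (fun s x => E s x)
          (fun (π : Equiv.Perm (Block d)) x => π x) m).1 ⟨⟨_, hA.mapAnswers _⟩, rfl⟩
    _ = _ := by rw [sum_const, card_univ, nsmul_eq_mul, mul_comm]

theorem acceptProb_add_swap {X Y : Type} [AddCommMagma Y]
    {S T : Type*} [Fintype S] [Nonempty S] [Fintype T] [Nonempty T]
    (F : S → X → Y) (g : T → X → Y) (A : OracleAlg X Y) :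
    OracleAlg.acceptProb (fun (p : S × T) x => F p.1 x + g p.2 x) A
      = OracleAlg.acceptProb (fun (p : T × S) x => g p.1 x + F p.2 x) A := by
  rw [OracleAlg.acceptProb_eq, OracleAlg.acceptProb_eq, Fintype.card_prod, Fintype.card_prod,
    mul_comm, ← Equiv.sum_comp (Equiv.prodComm S T)]
  congr 1
  refine sum_congr rfl fun p _ => ?_
  congr 1
  funext x
  exact add_comm _ _

end Hybrid

theorem mainTheorem10 :
    ∃ C : ℝ, 0 < C ∧
      ∀ (d m : ℕ) (K : Type*) [Fintype K] [Nonempty K] (E : K → Equiv.Perm (Block d)),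
        m < 2 ^ d →
          prfAdvantage (xorConstruction E) m
            ≤ 2 * prpAdvantage E m + C * ((m : ℝ) / (2 : ℝ) ^ (3 * (d : ℝ) / 2)) := by
  refine ⟨√fourthMomentConst, Real.sqrt_pos.2 fourthMomentConst_pos, ?_⟩
  intro d m K _ _ E hm
  refine (maxAdvantage_isLUB (xorConstruction E)
    (fun f : Block d → Block d => f) m).2 ?_
  rintro _ ⟨⟨A, hA⟩, rfl⟩
  have hcard : Fintype.card (Block d) = 2 ^ d := by simp
  -- The chain is `E + E`, `π + E`, `π + π`, uniform function; the swap in `h2` lets the same lemma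
  -- replace the second summand.
  have h1 := abs_acceptProb_add_sub_le_prpAdvantage E (fun s x => E s x) A hA
  have h2 := abs_acceptProb_add_sub_le_prpAdvantage E
    (fun (π : Equiv.Perm (Block d)) x => π x) A hA
  rw [acceptProb_add_swap (fun s x => E s x) (fun (π : Equiv.Perm (Block d)) x => π x)] at h2
  have h3 := sq_acceptProb_permSum_sub_le isSignPairing_blockSign block_add_eq_zero_iff
    (hcard.symm ▸ hm) A hA
  have hpow : ((2 : ℝ) ^ (3 * (d : ℝ) / 2)) ^ 2 = (Fintype.card (Block d) : ℝ) ^ 3 := by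
    rw [hcard, ← Real.rpow_natCast, ← Real.rpow_mul (by norm_num)]
    push_cast
    rw [← pow_mul, ← Real.rpow_natCast]
    congr 1
    push_cast
    ring
  have h4 : |OracleAlg.acceptProb
        (fun (p : Equiv.Perm (Block d) × Equiv.Perm (Block d)) x => p.1 x + p.2 x) A
        - OracleAlg.acceptProb (fun f : Block d → Block d => f) A|
      ≤ √fourthMomentConst * ((m : ℝ) / (2 : ℝ) ^ (3 * (d : ℝ) / 2)) := by
    refine abs_le_of_sq_le_sq (h3.trans_eq ?_) (by positivity)
    rw [mul_pow, Real.sq_sqrt fourthMomentConst_pos.le, div_pow, hpow, mul_div_assoc]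
  have hx : OracleAlg.acceptProb (xorConstruction E) A
      = OracleAlg.acceptProb (fun (p : K × K) x => E p.1 x + E p.2 x) A := rfl
  simp only [OracleAlg.advantage, hx]
  rw [abs_le] at h1 h2 h4 ⊢
  constructor <;> linarith [h1.1, h1.2, h2.1, h2.2, h4.1, h4.2]
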